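/- Fix integers $K,L\ge 1$, a real $M>0$ and probability distributions $D,D'$ on $\mathbb R$. For each $n$ for which $Mn$ is an integer consider the following random market with $n$ students and $Mn$ schools. Each student independently has a uniformly random strict ordering of all schools and applies to her $K$ favourite schools. Each school $u$ draws an independent signal for every student, from $D$ if $u$ is the student's favourite school and from $D'$ otherwise, and ranks the students in decreasing order of signal (ties, if $D,D'$ have atoms, are broken independently and uniformly at random). Each school has $L$ places. A matching assigns each student to at most one school and at most $L$ students to each school; it is stable if students are matched only to schools they applied to, and there is no student $s$ and school $u$ such that $s$ applied to $u$, $s$ is unmatched or prefers $u$ to her school, and $u$ has a free place or prefers $s$ to one of its matched students. For $x\in\mathbb R^K$ let $f^{(n)}_i(x)\cdot n$ be the expected number of accepted proposals of type $i$ when $\max(0,\lfloor x_jn\rfloor)$ proposals of type $j$ are made for each $j\in[K]$, each independently to a uniformly random one of $Mn$ schools, where each school draws independent signals, from $D$ for proposals of type $1$ and from $D'$ for all other proposals, and accepts the $L$ proposals with the highest signals among those it received (all of them if there are fewer than $L$; ties are broken as above). Let $y=(y_1,\dots,y_K)$ (a fixed vector or, more generally, a vector depending on $n$) be a solution of the system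 $$y_1=1\pm o(1),\qquad y_{i+1}=y_i-f^{(n)}_i(y)\pm o(1)\quad(1\le i\le K-1)\qquad (n\to\infty).$$ Then, with probability $1-o(1)$ over the random preferences, there is a stable matching in which, for every $i\in[K-1]$ simultaneously, $(y_i-y_{i+1})n\pm o(n)$ students are matched to their $i$-th favourite school. Here $n\to\infty$ along any sequence of integers with $Mn$ an integer, while $K,L,M,D,D'$ are fixed. -/

import Mathlib

open MeasureTheory ProbabilityTheory Filter Topology

namespace MatchingMarket

/-- The finite set of permutations carries the discrete sigma-algebra. -/
instance instMeasurableSpacePerm (m : ℕ) : MeasurableSpace (Equiv.Perm (Fin m)) := ⊤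

/-- A score is a pair consisting of a signal and a tie-breaker.  `Better a b` says that the score
`a` beats the score `b`: it has the larger signal or, if the signals agree, the larger
tie-breaker. -/
def Better (a b : ℝ × ℝ) : Prop := b.1 < a.1 ∨ (b.1 = a.1 ∧ b.2 < a.2)

/-- The law of a score whose signal has law `D`: the tie-breaker is independent of the signal and
uniform on `[0,1]`. (If `D` has no atoms, tie-breakers play no role almost surely.) -/
noncomputable def scoreLaw (D : Measure ℝ) : Measure (ℝ × ℝ) :=
  D.prod (volume.restrict (Set.Icc (0 : ℝ) 1))

/-! ### Markets and stable matchings -/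

/-- The preferences in a market with `n` students and `m` universities. The university `pref s k`
is the `(k+1)`-st favourite of the student `s`; the university `u` ranks the students in decreasing
order of the scores `score u s`. -/
structure Market (n m : ℕ) where
  pref : Fin n → Equiv.Perm (Fin m)
  score : Fin m → Fin n → ℝ × ℝ

variable {n m : ℕ}

/-- The position of the university `u` on the list of the student `s`, counted from `0`. -/
def Market.rank (P : Market n m) (s : Fin n) (u : Fin m) : ℕ := ((P.pref s).symm u : ℕ)

/-- A matching in which universities enroll at most `L` students: `μ s = some u` if `s` is matched
to `u`, and `μ s = none` if `s` is unmatched. -/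
def IsMatching (L : ℕ) (μ : Fin n → Option (Fin m)) : Prop :=
  ∀ u, {s | μ s = some u}.ncard ≤ L

/-- The student `s` prefers `u` to her partner in `μ`, when every student finds exactly her `K`
favourite universities acceptable (she applies to those only). -/
def Market.StudentPrefers (P : Market n m) (K : ℕ) (μ : Fin n → Option (Fin m))
    (s : Fin n) (u : Fin m) : Prop :=
  P.rank s u < K ∧ ∀ v, μ s = some v → P.rank s u < P.rank s v

/-- The university `u` prefers the applicant `s` to one of its `L` partners in `μ`, where unfilled
places count as partners that are worse than any applicant. -/
def Market.UniversityPrefers (P : Market n m) (L : ℕ) (μ : Fin n → Option (Fin m))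
    (u : Fin m) (s : Fin n) : Prop :=
  {s' | μ s' = some u}.ncard < L ∨ ∃ s', μ s' = some u ∧ Better (P.score u s) (P.score u s')

/-- `μ` is a stable matching, when each student applies to her `K` favourite universities and each
university has `L` places: students are matched only to universities they applied to, and there is
no blocking pair. -/
def Market.IsStable (P : Market n m) (K L : ℕ) (μ : Fin n → Option (Fin m)) : Prop :=
  IsMatching L μ ∧ (∀ s u, μ s = some u → P.rank s u < K) ∧
    ¬ ∃ s u, P.StudentPrefers K μ s u ∧ P.UniversityPrefers L μ u s

/-- The number of students that `μ` matches to the university at position `i` (from `0`) of their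
list. -/
noncomputable def Market.numMatched (P : Market n m) (μ : Fin n → Option (Fin m)) (i : ℕ) : ℕ :=
  {s | ∃ u, μ s = some u ∧ P.rank s u = i}.ncard

/-! ### Random preferences -/

/-- The randomness behind a market: the lists of the students and, for every university `u` and
every student `s`, one score to be used if `u` is the favourite of `s` and one to be used
otherwise. -/
abbrev Sample (n m : ℕ) : Type :=
  (Fin n → Equiv.Perm (Fin m)) × (Fin m → Fin n → (ℝ × ℝ) × (ℝ × ℝ))

/-- The lists of the students are independent uniformly random orderings of the universities; all
scores are independent of each other and of the lists, with signals of law `D` or `D'`. -/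
noncomputable def sampleLaw (n m : ℕ) (D D' : Measure ℝ) : Measure (Sample n m) :=
  (Measure.pi fun _ : Fin n => uniformOn (Set.univ : Set (Equiv.Perm (Fin m)))).prod
    (Measure.pi fun _ : Fin m => Measure.pi fun _ : Fin n => (scoreLaw D).prod (scoreLaw D'))

/-- The market determined by a sample: the university `u` observes a signal drawn from `D` for the
students whose favourite is `u`, and a signal drawn from `D'` for all other students. -/
noncomputable def market (ω : Sample n m) : Market n m where
  pref := ω.1
  score u s := if ((ω.1 s).symm u : ℕ) = 0 then (ω.2 u s).1 else (ω.2 u s).2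

/-! ### The system of equations -/

/-- The proposals when `⌊x i * n⌋` proposals of type `i` are made for every `i`; the Lean index `i`
stands for type `i + 1`. -/
abbrev Proposal (n : ℕ) {K : ℕ} (x : Fin K → ℝ) : Type := Σ i : Fin K, Fin ⌊x i * n⌋₊

/-- Independently for all proposals: each goes to a uniformly random university, which draws its
signal from `D` if it is of the first type and from `D'` otherwise. -/
noncomputable def proposalLaw (n m : ℕ) (D D' : Measure ℝ) {K : ℕ} (x : Fin K → ℝ) :
    Measure (Proposal n x → Fin m × (ℝ × ℝ)) :=
  Measure.pi fun p => (uniformOn (Set.univ : Set (Fin m))).prod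
    (scoreLaw (if (p.1 : ℕ) = 0 then D else D'))

/-- The proposal `p` is among the `L` best proposals received by its university. -/
def Accepted (L : ℕ) {ι : Type} (ω : ι → Fin m × (ℝ × ℝ)) (p : ι) : Prop :=
  {q | (ω q).1 = (ω p).1 ∧ Better (ω q).2 (ω p).2}.ncard < L

/-- The expected number of accepted proposals of type `i`, divided by `n`. -/
noncomputable def acceptedRate (n m : ℕ) (D D' : Measure ℝ) (L : ℕ) {K : ℕ} (x : Fin K → ℝ)
    (i : Fin K) : ℝ :=
  (∫ ω, ({p : Proposal n x | p.1 = i ∧ Accepted L ω p}.ncard : ℝ) ∂(proposalLaw n m D D' x)) / n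

/-- Along markets with `n t` students and `m t` universities, `y t` solves the system of equations
`y 1 = 1`, `y (i+1) = y i - f i y` (with `f` the rate of acceptance) up to an error that tends
to `0`.  In particular, `y t` may be the same vector for all `t`. -/
def IsSolution (n m : ℕ → ℕ) (D D' : Measure ℝ) (L : ℕ) {K : ℕ} (y : ℕ → Fin K → ℝ) : Prop :=
  (∀ i : Fin K, (i : ℕ) = 0 → Tendsto (fun t => y t i) atTop (𝓝 1)) ∧
    ∀ i j : Fin K, (j : ℕ) = i + 1 →
      Tendsto (fun t => y t j - (y t i - acceptedRate (n t) (m t) D D' L (y t) i)) atTop (𝓝 0)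

end MatchingMarket

namespace MatchingMarket

/-! ### Rejections in a fixed set of proposals -/

/-! The matching comes from deferred acceptance, described without time: a final state is a set of
proposals `(s, k)` that contains each student's first proposal and contains each later one exactly
when the preceding one is rejected within the set. Adding proposals only adds rejections, so a final
state exists as a fixed point of a monotone map (`exists_isFinalState`), and its accepted proposals
form a stable matching (`Market.isStable_matchingOf`). If `X k` is the number of proposals of type
`k` in it, then `X (i+1)` counts the rejected proposals of type `i`, and `X i - X (i+1)` students
get their `i`-th favourite. It remains to show `X k ≈ y k * n`.

The first `K` entries of the lists have bounded density with respect to independent proposals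
(`sampleLaw_proposals_le` and `pow_div_descFactorial_pow_le`), so independent proposals may be
studied instead. A union bound over all candidate sets would be far too expensive. Instead, for
given counts `X`, the array is read in an order depending on the candidate set; this preserves
probabilities and makes the events for different candidates disjoint. Hence some final state with
counts `X` exists with at most the probability that one fixed set with counts `X` has the matching
numbers of rejections (`measureReal_exists_isFinalState_le`). By bounded differences these numbers
are concentrated, and there are only polynomially many `X`. So with high probability the counts of
every final state satisfy `X (i+1) = meanRejected X i` up to a small multiple of `n`.

The counts `⌊y k * n⌋₊` satisfy the same approximate system. The map from `X` to `meanRejected X` is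
an ℓ¹ contraction, with factor bounded away from 1 uniformly in `n`: an additional proposal causes
at most one more rejection, and none if its university has received no other
(`sum_abs_meanRejected_sub_le`). Two approximate solutions are therefore close. A diagonal argument
turns errors `η * n` for every fixed `η > 0` into one error `o(n)`. -/

/-- A relation comparing exactly the proposals that go to the same university, strictly and
totally. -/
structure IsRanking {ι κ : Type*} (u : ι → κ) (B : ι → ι → Prop) : Prop where
  same : ∀ {a b}, B a b → u a = u b
  irrefl : ∀ a, ¬ B a a
  trans : ∀ {a b c}, B a b → B b c → B a c
  total : ∀ {a b}, u a = u b → a = b ∨ B a b ∨ B b a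

open Classical in
/-- The proposals in `S` that are beaten by at least `L` others in `S`. -/
noncomputable def rejected {ι : Type*} (L : ℕ) (B : ι → ι → Prop) (S : Finset ι) : Finset ι :=
  {p ∈ S | L ≤ ({q ∈ S | B q p} : Finset ι).card}

section Rejected

open Classical

variable {ι κ : Type*} {L : ℕ} {u : ι → κ} {B : ι → ι → Prop} {S T : Finset ι}

theorem mem_rejected {p : ι} :
    p ∈ rejected L B S ↔ p ∈ S ∧ L ≤ ({q ∈ S | B q p} : Finset ι).card := by
  simp [rejected]

theorem rejected_subset : rejected L B S ⊆ S := fun _ hp => (mem_rejected.1 hp).1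

theorem rejected_mono (h : S ⊆ T) : rejected L B S ⊆ rejected L B T := by
  intro p hp
  rw [mem_rejected] at hp ⊢
  exact ⟨h hp.1, hp.2.trans (Finset.card_le_card (Finset.filter_subset_filter _ h))⟩

/-- A newly rejected proposal is either `p` or the one that held the last place of the university of
`p` and is displaced by `p`. There is at most one of the latter, and the two cases exclude each
other. -/
theorem card_rejected_insert_le (hB : IsRanking u B) {p : ι} (hp : p ∉ S) :
    (rejected L B (insert p S)).card ≤ (rejected L B S).card + 1 := by
  have key : ∀ q ∈ S, q ∈ rejected L B (insert p S) → q ∉ rejected L B S →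
      B p q ∧ ({r ∈ S | B r q} : Finset ι).card + 1 = L := by
    intro q hqS hq hq'
    rw [mem_rejected] at hq hq'
    have h1 : ({r ∈ S | B r q} : Finset ι).card < L := by
      by_contra h; exact hq' ⟨hqS, not_lt.1 h⟩
    have h2 := hq.2
    rw [Finset.filter_insert] at h2
    split_ifs at h2 with hb
    · refine ⟨hb, ?_⟩
      have := Finset.card_insert_le p ({r ∈ S | B r q} : Finset ι)
      omega
    · omega
  have huniq : ∀ q ∈ rejected L B (insert p S), q ∉ rejected L B S →
      ∀ q' ∈ rejected L B (insert p S), q' ∉ rejected L B S → q = q' := by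
    -- The number of better proposals strictly increases along `B`, so comparable proposals cannot
    -- both have exactly `L - 1` better ones.
    have haux : ∀ q ∈ S, ∀ q' ∈ S, ({r ∈ S | B r q} : Finset ι).card + 1 = L →
        ({r ∈ S | B r q'} : Finset ι).card + 1 = L → ¬ B q q' := by
      intro q hq q' _ h1 h2 hb
      have : insert q ({r ∈ S | B r q} : Finset ι) ⊆ ({r ∈ S | B r q'} : Finset ι) := by
        intro r hr
        rw [Finset.mem_insert] at hr
        rcases hr with rfl | hr
        · simp [hq, hb]
        · rw [Finset.mem_filter] at hr ⊢
          exact ⟨hr.1, hB.trans hr.2 hb⟩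
      have h3 := Finset.card_le_card this
      rw [Finset.card_insert_of_notMem (by simp [hB.irrefl])] at h3
      omega
    -- If `p` displaces `q`, everything that beats `p` also beats `q`, so at most `L - 1` proposals
    -- beat `p`, which is therefore kept.
    have hpq : ∀ q ∈ S, q ∈ rejected L B (insert p S) → q ∉ rejected L B S →
        p ∉ rejected L B (insert p S) := by
      intro q hqS hq hq' hpr
      obtain ⟨hb, hc⟩ := key q hqS hq hq'
      have h2 := (mem_rejected.1 hpr).2
      rw [Finset.filter_insert, if_neg (hB.irrefl p)] at h2
      have : ({r ∈ S | B r p} : Finset ι).card ≤ ({r ∈ S | B r q} : Finset ι).card := by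
        apply Finset.card_le_card
        intro r hr
        rw [Finset.mem_filter] at hr ⊢
        exact ⟨hr.1, hB.trans hr.2 hb⟩
      omega
    intro q hq hq1 q' hq' hq1'
    rcases Finset.mem_insert.1 (rejected_subset hq) with h | h <;>
      rcases Finset.mem_insert.1 (rejected_subset hq') with h' | h'
    · rw [h, h']
    · subst h
      exact absurd hq (hpq q' h' hq' hq1')
    · subst h'
      exact absurd hq' (hpq q h hq hq1)
    · obtain ⟨hb, hc⟩ := key q h hq hq1
      obtain ⟨hb', hc'⟩ := key q' h' hq' hq1'
      rcases hB.total ((hB.same hb).symm.trans (hB.same hb')) with h3 | h3 | h3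
      · exact h3
      · exact absurd h3 (haux q h q' h' hc hc')
      · exact absurd h3 (haux q' h' q h hc' hc)
  have hd : (rejected L B (insert p S) \ rejected L B S).card ≤ 1 := by
    rw [Finset.card_le_one]
    intro a ha b hb
    rw [Finset.mem_sdiff] at ha hb
    exact huniq a ha.1 ha.2 b hb.1 hb.2
  have := Finset.card_sdiff_add_card_eq_card
    (rejected_mono (L := L) (B := B) (Finset.subset_insert p S))
  omega

/-- A proposal that is alone at its university displaces nobody and, since `1 ≤ L`, is kept. The
contraction rests on this. -/
theorem rejected_insert_of_fresh (hB : IsRanking u B) (hL : 1 ≤ L) {p : ι}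
    (hp : ∀ q ∈ S, u q ≠ u p) : rejected L B (insert p S) = rejected L B S := by
  ext q
  rw [mem_rejected, mem_rejected]
  constructor
  · rintro ⟨hq, hc⟩
    rw [Finset.mem_insert] at hq
    rcases hq with rfl | hq
    · exfalso
      have : ({r ∈ insert q S | B r q} : Finset ι) = ∅ := by
        rw [Finset.filter_eq_empty_iff]
        intro r hr hb
        rcases Finset.mem_insert.1 hr with rfl | hr
        · exact hB.irrefl _ hb
        · exact hp r hr (hB.same hb)
      rw [this] at hc
      simp at hc
      omega
    · rw [Finset.filter_insert, if_neg (fun h => hp q hq (hB.same h).symm)] at hc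
      exact ⟨hq, hc⟩
  · rintro ⟨hq, hc⟩
    exact mem_rejected.1 (rejected_mono (Finset.subset_insert p S) (mem_rejected.2 ⟨hq, hc⟩))

/-- Exactly `min L |T|` elements of a set of proposals to one university are beaten by fewer than
`L` others. -/
theorem card_filter_rank_lt (hB : IsRanking u B) (hT : ∀ a ∈ T, ∀ b ∈ T, u a = u b) :
    ({p ∈ T | ({q ∈ T | B q p} : Finset ι).card < L} : Finset ι).card = min L T.card := by
  have hlt : ∀ a ∈ T, ∀ b, B a b →
      ({q ∈ T | B q a} : Finset ι).card < ({q ∈ T | B q b} : Finset ι).card := by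
    intro a ha b hb
    apply Finset.card_lt_card
    rw [Finset.ssubset_iff]
    refine ⟨a, by simp [hB.irrefl], ?_⟩
    intro r hr
    rw [Finset.mem_insert] at hr
    rcases hr with rfl | hr
    · simp [ha, hb]
    · rw [Finset.mem_filter] at hr ⊢
      exact ⟨hr.1, hB.trans hr.2 hb⟩
  have hinj : Set.InjOn (fun p => ({q ∈ T | B q p} : Finset ι).card) T := by
    intro a ha b hb hab
    rcases hB.total (hT a ha b hb) with h | h | h
    · exact h
    · exact absurd hab (hlt a ha b h).ne
    · exact absurd hab (hlt b hb a h).ne'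
  -- The rank is injective with values below `T.card`, hence takes each of these values once.
  have himg : T.image (fun p => ({q ∈ T | B q p} : Finset ι).card) = Finset.range T.card := by
    apply Finset.eq_of_subset_of_card_le
    · intro k hk
      obtain ⟨p, hp, rfl⟩ := Finset.mem_image.1 hk
      rw [Finset.mem_range]
      apply Finset.card_lt_card
      rw [Finset.ssubset_iff]
      exact ⟨p, by simp [hB.irrefl], by
        intro r hr
        rcases Finset.mem_insert.1 hr with rfl | hr
        · exact hp
        · exact (Finset.mem_filter.1 hr).1⟩
    · rw [Finset.card_range, Finset.card_image_of_injOn hinj]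
  rw [← Finset.card_image_of_injOn (f := fun p => ({q ∈ T | B q p} : Finset ι).card)
    (hinj.mono (Finset.coe_subset.2 (Finset.filter_subset _ _)))]
  have : ({p ∈ T | ({q ∈ T | B q p} : Finset ι).card < L} : Finset ι).image
      (fun p => ({q ∈ T | B q p} : Finset ι).card) = Finset.range (min L T.card) := by
    ext k
    rw [Finset.range_eq_Ico, Finset.mem_image]
    constructor
    · rintro ⟨p, hp, rfl⟩
      rw [Finset.mem_filter] at hp
      have := himg ▸ Finset.mem_image_of_mem
        (fun p => ({q ∈ T | B q p} : Finset ι).card) hp.1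
      simp only [Finset.mem_range] at this
      simp [hp.2, this]
    · intro hk
      simp only [Finset.mem_Ico, zero_le, true_and, lt_min_iff] at hk
      obtain ⟨p, hp, h⟩ := Finset.mem_image.1 (himg.symm ▸ Finset.mem_range.2 hk.2)
      exact ⟨p, by rw [Finset.mem_filter]; exact ⟨hp, by rw [h]; exact hk.1⟩, h⟩
  rw [this, Finset.card_range]

theorem rejected_congr {B' : ι → ι → Prop} (h : ∀ a ∈ S, ∀ b ∈ S, B a b ↔ B' a b) :
    rejected L B S = rejected L B' S := by
  ext p
  rw [mem_rejected, mem_rejected]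
  refine and_congr_right fun hp => ?_
  rw [Finset.filter_congr fun q hq => h q hq p hp]

theorem rejected_map {ι' : Type*} {B' : ι' → ι' → Prop} (e : ι ↪ ι')
    (h : ∀ a b, B a b ↔ B' (e a) (e b)) :
    rejected L B' (S.map e) = (rejected L B S).map e := by
  ext p
  rw [mem_rejected, Finset.mem_map, Finset.mem_map]
  constructor
  · rintro ⟨⟨q, hq, rfl⟩, hc⟩
    refine ⟨q, mem_rejected.2 ⟨hq, ?_⟩, rfl⟩
    rw [Finset.filter_map, Finset.card_map] at hc
    simpa only [Function.comp_def, ← h] using hc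
  · rintro ⟨q, hq, rfl⟩
    rw [mem_rejected] at hq
    refine ⟨⟨q, hq.1, rfl⟩, ?_⟩
    rw [Finset.filter_map, Finset.card_map]
    simpa only [Function.comp_def, ← h] using hq.2

end Rejected

/-! ### The ranking given by the scores -/

theorem Better.trans {a b c : ℝ × ℝ} (h : Better a b) (h' : Better b c) : Better a c := by
  unfold Better at *
  rcases h with h | h <;> rcases h' with h' | h'
  · exact Or.inl (h'.trans h)
  · exact Or.inl (h'.1 ▸ h)
  · exact Or.inl (h.1 ▸ h')
  · exact Or.inr ⟨h'.1.trans h.1, h'.2.trans h.2⟩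

theorem Better.irrefl (a : ℝ × ℝ) : ¬ Better a a := by simp [Better]

theorem better_total {a b : ℝ × ℝ} (h : a ≠ b) : Better a b ∨ Better b a := by
  unfold Better
  rcases lt_trichotomy a.1 b.1 with h1 | h1 | h1
  · exact Or.inr (Or.inl h1)
  · rcases lt_trichotomy a.2 b.2 with h2 | h2 | h2
    · exact Or.inr (Or.inr ⟨h1, h2⟩)
    · exact absurd (Prod.ext h1 h2) h
    · exact Or.inl (Or.inr ⟨h1.symm, h2⟩)
  · exact Or.inl (Or.inl h1)

variable {ι : Type*} {m : ℕ}

/-- The proposal `q` goes to the same university as `p` and has the better score. -/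
def Beats (d : ι → Fin m × (ℝ × ℝ)) (q p : ι) : Prop :=
  (d q).1 = (d p).1 ∧ Better (d q).2 (d p).2

/-- As `Beats`, with proposals of equal scores compared by means of an injection into `ℕ`. -/
def BeatsOrTie (e : ι → ℕ) (d : ι → Fin m × (ℝ × ℝ)) (q p : ι) : Prop :=
  (d q).1 = (d p).1 ∧ (Better (d q).2 (d p).2 ∨ (d q).2 = (d p).2 ∧ e q < e p)

/-- No two proposals have the same score. -/
def TieFree (d : ι → Fin m × (ℝ × ℝ)) : Prop := ∀ p q, p ≠ q → (d p).2 ≠ (d q).2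

theorem isRanking_beats {d : ι → Fin m × (ℝ × ℝ)} (hd : TieFree d) :
    IsRanking (fun p => (d p).1) (Beats d) where
  same h := h.1
  irrefl a h := Better.irrefl _ h.2
  trans h h' := ⟨h.1.trans h'.1, h.2.trans h'.2⟩
  total {a b} h := by
    by_cases hab : a = b
    · exact Or.inl hab
    · rcases better_total (hd a b hab) with h1 | h1
      · exact Or.inr (Or.inl ⟨h, h1⟩)
      · exact Or.inr (Or.inr ⟨h.symm, h1⟩)

theorem isRanking_beatsOrTie {e : ι → ℕ} (he : e.Injective) (d : ι → Fin m × (ℝ × ℝ)) :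
    IsRanking (fun p => (d p).1) (BeatsOrTie e d) where
  same h := h.1
  irrefl a h := by
    rcases h.2 with h | h
    · exact Better.irrefl _ h
    · exact lt_irrefl _ h.2
  trans {a b c} h h' := by
    refine ⟨h.1.trans h'.1, ?_⟩
    rcases h.2 with h1 | h1 <;> rcases h'.2 with h2 | h2
    · exact Or.inl (h1.trans h2)
    · exact Or.inl (h2.1 ▸ h1)
    · exact Or.inl (h1.1 ▸ h2)
    · exact Or.inr ⟨h1.1.trans h2.1, h1.2.trans h2.2⟩
  total {a b} h := by
    by_cases hab : a = b
    · exact Or.inl hab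
    · by_cases hs : (d a).2 = (d b).2
      · rcases lt_or_gt_of_ne (he.ne hab) with h1 | h1
        · exact Or.inr (Or.inl ⟨h, Or.inr ⟨hs, h1⟩⟩)
        · exact Or.inr (Or.inr ⟨h.symm, Or.inr ⟨hs.symm, h1⟩⟩)
      · rcases better_total hs with h1 | h1
        · exact Or.inr (Or.inl ⟨h, Or.inl h1⟩)
        · exact Or.inr (Or.inr ⟨h.symm, Or.inl h1⟩)

theorem beatsOrTie_eq_beats (e : ι → ℕ) {d : ι → Fin m × (ℝ × ℝ)} (hd : TieFree d) :
    BeatsOrTie e d = Beats d := by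
  funext q p
  apply propext
  constructor
  · rintro ⟨h, h1 | h1⟩
    · exact ⟨h, h1⟩
    · by_cases hqp : q = p
      · subst hqp; exact absurd h1.2 (lt_irrefl _)
      · exact absurd h1.1 (hd q p hqp)
  · rintro ⟨h, h1⟩
    exact ⟨h, Or.inl h1⟩

/-! ### The bounded differences inequality -/

theorem integrable_of_abs_le {Ω : Type*} [MeasurableSpace Ω] {μ : Measure Ω} [IsFiniteMeasure μ]
    {f : Ω → ℝ} (hf : Measurable f) {C : ℝ} (hC : ∀ ω, |f ω| ≤ C) : Integrable f μ :=
  Integrable.of_bound hf.aestronglyMeasurable C (ae_of_all _ hC)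

/-- McDiarmid's inequality for moment generating functions, by induction on the coordinates. Given
the first coordinate, the rest has parameter `N` around the conditional mean `g`; by Hoeffding's
lemma `g` has parameter 1 around `E`; the parameters add. The bound `C` serves integrability only.
-/
theorem hasSubgaussianMGF_of_bounded_differences_fin {α : Type*} [MeasurableSpace α] (N : ℕ)
    (μ : Fin N → Measure α) [∀ i, IsProbabilityMeasure (μ i)] (f : (Fin N → α) → ℝ)
    (hf : Measurable f) (C : ℝ) (hC : ∀ d, |f d| ≤ C)
    (hbd : ∀ d i a, |f (Function.update d i a) - f d| ≤ 1) :
    HasSubgaussianMGF (fun d => f d - ∫ d', f d' ∂Measure.pi μ) N (Measure.pi μ) := by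
  induction N with
  | zero =>
    have hconst : ∀ d, f d = f default := fun d => by rw [Subsingleton.elim d default]
    have h0 : (fun d => f d - ∫ d', f d' ∂Measure.pi μ) = fun _ => 0 := by
      funext d
      simp only [hconst]
      simp
    rw [h0]
    exact ⟨fun t => by simp, fun t => by simp [mgf]⟩
  | succ N ih =>
    set ν : Measure (Fin N → α) := Measure.pi fun j => μ j.succ with hν
    set E := ∫ d', f d' ∂Measure.pi μ with hE
    have hmp := measurePreserving_piFinSuccAbove μ 0
    simp only [Fin.zero_succAbove] at hmp
    have hmp' := hmp.symm
    set c := (MeasurableEquiv.piFinSuccAbove (fun _ : Fin (N + 1) => α) 0).symm with hc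
    have hcc : ∀ a r, c (a, r) = Fin.cons a r := fun a r => by
      simp [hc, MeasurableEquiv.piFinSuccAbove, Fin.insertNthEquiv]
    have hfc : Measurable fun x : α × (Fin N → α) => f (c x) := hf.comp c.measurable
    have hCc : ∀ x, |f (c x)| ≤ C := fun x => hC _
    set g : α → ℝ := fun a => ∫ r, f (c (a, r)) ∂ν with hg
    have hgm : Measurable g := (hfc.stronglyMeasurable.integral_prod_right').measurable
    have hintr : ∀ a, Integrable (fun r => f (c (a, r))) ν := fun a =>
      integrable_of_abs_le (hfc.comp (by fun_prop)) (fun r => hCc _)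
    have hEg : E = ∫ a, g a ∂(μ 0) := by
      rw [hE, ← hmp'.integral_comp c.measurableEmbedding,
        integral_prod _ (integrable_of_abs_le hfc hCc)]
    have hgd : ∀ a b, |g a - g b| ≤ 1 := by
      intro a b
      rw [hg]
      simp only
      rw [← integral_sub (hintr a) (hintr b)]
      have := norm_integral_le_of_norm_le_const (μ := ν) (C := 1)
        (f := fun r => f (c (a, r)) - f (c (b, r))) (ae_of_all _ fun r => by
          have := hbd (c (b, r)) 0 a
          rw [hcc, Fin.update_cons_zero, ← hcc, ← hcc] at this
          simpa using this)
      simpa using this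
    have : Nonempty α := (μ 0).nonempty_of_neZero
    obtain ⟨a₀⟩ := this
    -- The values of `g` lie within 1 of `g a₀`, so in an interval of length 2, and Hoeffding's
    -- parameter is `(2 / 2) ^ 2 = 1`.
    have hgs : HasSubgaussianMGF (fun a => g a - E) 1 (μ 0) := by
      have := hasSubgaussianMGF_of_mem_Icc (μ := μ 0) (X := g) (a := g a₀ - 1) (b := g a₀ + 1)
        hgm.aemeasurable (ae_of_all _ fun a => by
          have := abs_le.1 (hgd a a₀)
          constructor <;> linarith)
      rw [← hEg] at this
      convert this using 1
      rw [show g a₀ + 1 - (g a₀ - 1) = 2 by ring]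
      ext; norm_num
    have hrs : ∀ a, HasSubgaussianMGF (fun r => f (c (a, r)) - g a) N ν := by
      intro a
      refine ih (fun j => μ j.succ) (fun r => f (c (a, r))) (hfc.comp (by fun_prop))
        (fun r => hCc _) ?_
      intro r i b
      have := hbd (c (a, r)) i.succ b
      rw [hcc, ← Fin.cons_update] at this
      simpa only [hcc] using this
    have hexpint : ∀ t, Integrable (fun x => Real.exp (t * (f (c x) - E))) ((μ 0).prod ν) := by
      intro t
      exact integrable_exp_mul_of_mem_Icc (a := -C - E) (b := C - E)
        (hfc.sub_const E).aemeasurable (ae_of_all _ fun x => by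
          have := abs_le.1 (hCc x)
          constructor <;> linarith)
    refine ⟨fun t => ?_, fun t => ?_⟩
    · rw [← hmp'.integrable_comp_emb c.measurableEmbedding]
      exact hexpint t
    · have h1 : mgf (fun d => f d - E) (Measure.pi μ) t
          = ∫ a, ∫ r, Real.exp (t * (f (c (a, r)) - E)) ∂ν ∂(μ 0) := by
        rw [mgf, ← hmp'.integral_comp c.measurableEmbedding, integral_prod _ (hexpint t)]
      have h2 : ∀ a, ∫ r, Real.exp (t * (f (c (a, r)) - E)) ∂ν
          ≤ Real.exp (N * t ^ 2 / 2) * Real.exp (t * (g a - E)) := by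
        intro a
        have : ∀ r, Real.exp (t * (f (c (a, r)) - E))
            = Real.exp (t * (f (c (a, r)) - g a)) * Real.exp (t * (g a - E)) := by
          intro r
          rw [← Real.exp_add]
          ring_nf
        simp only [this]
        rw [integral_mul_const]
        refine mul_le_mul_of_nonneg_right ?_ (Real.exp_pos _).le
        simpa [mgf] using (hrs a).mgf_le t
      rw [h1]
      calc ∫ a, ∫ r, Real.exp (t * (f (c (a, r)) - E)) ∂ν ∂(μ 0)
          ≤ ∫ a, Real.exp (N * t ^ 2 / 2) * Real.exp (t * (g a - E)) ∂(μ 0) :=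
            integral_mono (hexpint t).integral_prod_left
              ((hgs.integrable_exp_mul t).const_mul _) h2
        _ = Real.exp (N * t ^ 2 / 2) * mgf (fun a => g a - E) (μ 0) t := by
            rw [integral_const_mul, mgf]
        _ ≤ Real.exp (N * t ^ 2 / 2) * Real.exp (1 * t ^ 2 / 2) :=
            mul_le_mul_of_nonneg_left (by simpa using hgs.mgf_le t) (Real.exp_pos _).le
        _ = Real.exp (((N + 1 : ℕ) : NNReal) * t ^ 2 / 2) := by
            rw [← Real.exp_add]
            push_cast
            ring_nf

/-- Selecting coordinates by an injection pushes a product measure to the product measure. -/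
theorem measurePreserving_pi_precomp {ι ι' α : Type*} [Fintype ι] [Fintype ι'] [MeasurableSpace α]
    (μ : ι → Measure α) [∀ i, IsProbabilityMeasure (μ i)] {φ : ι' → ι} (hφ : φ.Injective) :
    MeasurePreserving (fun (d : ι → α) i => d (φ i)) (Measure.pi μ)
      (Measure.pi fun i => μ (φ i)) := by
  refine ⟨by fun_prop, ?_⟩
  have h := (iIndepFun_pi (μ := μ) (X := fun _ a => a) (fun i => aemeasurable_id)).precomp hφ
  rw [iIndepFun_iff_map_fun_eq_pi_map fun i => (measurable_pi_apply _).aemeasurable] at h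
  rw [h]
  congr
  funext i
  exact (measurePreserving_eval μ (φ i)).map_eq

theorem hasSubgaussianMGF_of_bounded_differences {ι α : Type*} [Fintype ι] [DecidableEq ι]
    [MeasurableSpace α]
    (μ : ι → Measure α) [∀ i, IsProbabilityMeasure (μ i)] (f : (ι → α) → ℝ)
    (hf : Measurable f) (C : ℝ) (hC : ∀ d, |f d| ≤ C)
    (hbd : ∀ d i a, |f (Function.update d i a) - f d| ≤ 1) :
    HasSubgaussianMGF (fun d => f d - ∫ d', f d' ∂Measure.pi μ) (Fintype.card ι)
      (Measure.pi μ) := by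
  set e := Fintype.equivFin ι
  have hmp := measurePreserving_pi_precomp μ e.symm.injective
  have hmp' := measurePreserving_pi_precomp (fun i => μ (e.symm i)) e.injective
  simp only [Equiv.symm_apply_apply] at hmp'
  have h := hasSubgaussianMGF_of_bounded_differences_fin (Fintype.card ι)
    (fun i => μ (e.symm i)) (fun d => f fun i => d (e i)) (by fun_prop) C (fun d => hC _) (by
      intro d i a
      have : (fun j => Function.update d i a (e j))
          = Function.update (fun j => d (e j)) (e.symm i) a := by
        funext j
        simp only [Function.update_apply, Equiv.eq_symm_apply]
      rw [this]
      exact hbd _ _ _)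
  have hint : ∫ d', f (fun i => d' (e i)) ∂Measure.pi (fun i => μ (e.symm i))
      = ∫ d', f d' ∂Measure.pi μ := by
    rw [← hmp'.map_eq, integral_map hmp'.aemeasurable hf.aestronglyMeasurable]
  rw [hint, ← hmp.map_eq] at h
  have := h.of_map hmp.aemeasurable
  simpa [Function.comp_def] using this

/-! ### Stable matchings from sets of proposals -/

/-- A set of proposals that may be made in the course of deferred acceptance and after which no
student has a proposal left to make: `(s, k) ∈ S` if `k` is the first type or the proposal of `s`
of the preceding type is rejected. -/
def IsFinalState {n K : ℕ} (L : ℕ) (B : Fin n × Fin K → Fin n × Fin K → Prop)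
    (S : Finset (Fin n × Fin K)) : Prop :=
  ∀ s k, (s, k) ∈ S ↔ (k : ℕ) = 0 ∨ ∃ j : Fin K, (k : ℕ) = j + 1 ∧ (s, j) ∈ rejected L B S

section FinalState

open Classical

variable {n m K L : ℕ} {B : Fin n × Fin K → Fin n × Fin K → Prop} {S : Finset (Fin n × Fin K)}

/-- Rejections grow with the set of proposals, so the defining rule is a monotone operator and
Knaster–Tarski gives a fixed point. Its minimality is not needed: the later estimates hold for all
final states at once. -/
theorem exists_isFinalState (L : ℕ) (B : Fin n × Fin K → Fin n × Fin K → Prop) :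
    ∃ S, IsFinalState L B S := by
  let F : Set (Fin n × Fin K) →o Set (Fin n × Fin K) :=
    { toFun := fun S => {p | (p.2 : ℕ) = 0 ∨
        ∃ j : Fin K, (p.2 : ℕ) = j + 1 ∧ (p.1, j) ∈ rejected L B S.toFinset}
      monotone' := by
        intro S T hST p hp
        rcases hp with hp | ⟨j, hj, hp⟩
        · exact Or.inl hp
        · exact Or.inr ⟨j, hj, rejected_mono (Set.toFinset_subset_toFinset.2 hST) hp⟩ }
  refine ⟨F.lfp.toFinset, fun s k => ?_⟩
  have h := F.map_lfp
  rw [Set.mem_toFinset]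
  nth_rw 1 [← h]
  rfl

/-- Descending along the list: each proposal in `S` after the first owes its presence to the
rejection of the preceding one. Hence each student has at most one accepted proposal. -/
theorem IsFinalState.mem_rejected_of_lt (hS : IsFinalState L B S) {s : Fin n} {j k : Fin K}
    (hk : (s, k) ∈ S) (hjk : j < k) : (s, j) ∈ rejected L B S := by
  obtain ⟨k, hkK⟩ := k
  induction k with
  | zero => exact absurd (Fin.lt_def.1 hjk) (Nat.not_lt_zero _)
  | succ k ih =>
    rcases (hS s _).1 hk with h | ⟨i, hi, hr⟩
    · simp at h
    · obtain ⟨i, hiK⟩ := i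
      obtain rfl : k = i := by simpa using hi
      rcases lt_or_eq_of_le (Nat.lt_succ_iff.1 (Fin.lt_def.1 hjk)) with h | h
      · exact ih _ (rejected_subset hr) h
      · have : j = ⟨k, by omega⟩ := Fin.ext h
        rwa [this]

theorem IsFinalState.eq_of_accepted (hS : IsFinalState L B S) {s : Fin n} {j k : Fin K}
    (hj : (s, j) ∈ S \ rejected L B S) (hk : (s, k) ∈ S \ rejected L B S) : j = k := by
  rw [Finset.mem_sdiff] at hj hk
  rcases lt_trichotomy j k with h | h | h
  · exact absurd (hS.mem_rejected_of_lt hk.1 h) hj.2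
  · exact h
  · exact absurd (hS.mem_rejected_of_lt hj.1 h) hk.2

theorem IsFinalState.mem_of_none_accepted (hS : IsFinalState L B S) {s : Fin n}
    (h : ∀ k, (s, k) ∉ S \ rejected L B S) (k : Fin K) : (s, k) ∈ S := by
  obtain ⟨k, hk⟩ := k
  induction k with
  | zero => exact (hS s _).2 (Or.inl rfl)
  | succ k ih =>
    refine (hS s _).2 (Or.inr ⟨⟨k, by omega⟩, rfl, ?_⟩)
    have := h ⟨k, by omega⟩
    rw [Finset.mem_sdiff, not_and_not_right] at this
    exact this (ih _)

/-- The first `K` entries of the lists of the students, with the corresponding scores. -/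
def Market.proposals (P : Market n m) (hK : K ≤ m) (p : Fin n × Fin K) : Fin m × (ℝ × ℝ) :=
  (P.pref p.1 (Fin.castLE hK p.2), P.score (P.pref p.1 (Fin.castLE hK p.2)) p.1)

/-- Every student is matched to the university that accepts one of her proposals. -/
noncomputable def Market.matchingOf (P : Market n m) (hK : K ≤ m) (L : ℕ)
    (S : Finset (Fin n × Fin K)) (s : Fin n) : Option (Fin m) :=
  if h : ∃ k, (s, k) ∈ S \ rejected L (Beats (P.proposals hK)) S then
    some (P.pref s (Fin.castLE hK h.choose)) else none

theorem Market.rank_pref (P : Market n m) (hK : K ≤ m) (s : Fin n) (k : Fin K) :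
    P.rank s (P.pref s (Fin.castLE hK k)) = k := by
  simp [Market.rank]

theorem Market.matchingOf_eq_some_iff (P : Market n m) (hK : K ≤ m)
    (hS : IsFinalState L (Beats (P.proposals hK)) S) {s : Fin n} {u : Fin m} :
    P.matchingOf hK L S s = some u ↔
      ∃ k, (s, k) ∈ S \ rejected L (Beats (P.proposals hK)) S ∧
        P.pref s (Fin.castLE hK k) = u := by
  unfold Market.matchingOf
  split_ifs with h
  · rw [Option.some_inj]
    constructor
    · exact fun hu => ⟨_, h.choose_spec, hu⟩
    · rintro ⟨k, hk, hu⟩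
      rw [hS.eq_of_accepted h.choose_spec hk, hu]
  · constructor
    · intro hu; simp at hu
    · rintro ⟨k, hk, _⟩; exact absurd ⟨k, hk⟩ h

/-- A university keeps its `L` best proposals, or all if there are fewer, and distinct accepted
proposals belong to distinct students. -/
theorem Market.ncard_matchingOf (P : Market n m) (hK : K ≤ m) (hT : TieFree (P.proposals hK))
    (hS : IsFinalState L (Beats (P.proposals hK)) S) (u : Fin m) :
    {s | P.matchingOf hK L S s = some u}.ncard
      = min L ({p ∈ S | (P.proposals hK p).1 = u} : Finset _).card := by
  rw [← card_filter_rank_lt (isRanking_beats hT) (by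
    intro a ha b hb
    rw [Finset.mem_filter] at ha hb
    exact ha.2.trans hb.2.symm)]
  rw [← Finset.card_image_of_injOn (f := Prod.fst), ← Set.ncard_coe_finset]
  · congr 1
    ext s
    rw [Set.mem_ofPred_eq, P.matchingOf_eq_some_iff hK hS, Finset.mem_coe, Finset.mem_image]
    constructor
    · rintro ⟨k, hk, hu⟩
      refine ⟨(s, k), ?_, rfl⟩
      rw [Finset.mem_sdiff, mem_rejected] at hk
      rw [Finset.mem_filter, Finset.mem_filter]
      refine ⟨⟨hk.1, hu⟩, ?_⟩
      -- Whatever beats a proposal to `u` goes to `u` too, so its rank within `S` equals its rank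
      -- among the proposals to `u`.
      rw [Finset.filter_filter]
      by_contra hc
      refine hk.2 ⟨hk.1, (not_lt.1 hc).trans (Finset.card_le_card ?_)⟩
      intro q hq
      rw [Finset.mem_filter] at hq ⊢
      exact ⟨hq.1, hq.2.2⟩
    · rintro ⟨⟨s', k⟩, hk, rfl⟩
      rw [Finset.mem_filter, Finset.mem_filter] at hk
      refine ⟨k, ?_, hk.1.2⟩
      rw [Finset.mem_sdiff, mem_rejected]
      refine ⟨hk.1.1, fun h => ?_⟩
      refine absurd hk.2 (not_lt.2 (h.2.trans (Finset.card_le_card ?_)))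
      intro q hq
      rw [Finset.mem_filter] at hq
      rw [Finset.mem_filter, Finset.mem_filter]
      exact ⟨⟨hq.1, hq.2.1.trans hk.1.2⟩, hq.2⟩
  · have aux : ∀ a ∈ ({p ∈ ({p ∈ S | (P.proposals hK p).1 = u} : Finset _) |
        ({q ∈ ({p ∈ S | (P.proposals hK p).1 = u} : Finset _) |
          Beats (P.proposals hK) q p} : Finset _).card < L} : Finset _),
        a ∈ S \ rejected L (Beats (P.proposals hK)) S := by
      intro a ha
      rw [Finset.mem_filter, Finset.mem_filter] at ha
      rw [Finset.mem_sdiff, mem_rejected]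
      refine ⟨ha.1.1, fun h => ?_⟩
      refine absurd ha.2 (not_lt.2 (h.2.trans (Finset.card_le_card ?_)))
      intro q hq
      rw [Finset.mem_filter] at hq
      rw [Finset.mem_filter, Finset.mem_filter]
      exact ⟨⟨hq.1, hq.2.1.trans ha.1.2⟩, hq.2⟩
    rintro ⟨s, j⟩ ha ⟨s', k⟩ hb (hab : s = s')
    subst hab
    rw [hS.eq_of_accepted (aux _ ha) (aux _ hb)]

/-- If `s` prefers `u`, then `s` has proposed to `u` and been rejected, so `u` received `L` better
proposals. Thus `u` is full, and a student accepted by `u` but ranked below `s` would also be beaten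
by those `L` proposals. -/
theorem Market.isStable_matchingOf (P : Market n m) (hK : K ≤ m) (hT : TieFree (P.proposals hK))
    (hS : IsFinalState L (Beats (P.proposals hK)) S) :
    P.IsStable K L (P.matchingOf hK L S) := by
  refine ⟨fun u => ?_, fun s u hu => ?_, ?_⟩
  · rw [P.ncard_matchingOf hK hT hS]
    exact min_le_left _ _
  · obtain ⟨k, _, rfl⟩ := (P.matchingOf_eq_some_iff hK hS).1 hu
    rw [P.rank_pref]
    exact k.2
  · rintro ⟨s, u, ⟨hr, hpref⟩, huniv⟩
    set k : Fin K := ⟨P.rank s u, hr⟩ with hk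
    have hku : P.pref s (Fin.castLE hK k) = u := by
      have : Fin.castLE hK k = (P.pref s).symm u := Fin.ext rfl
      rw [this, Equiv.apply_symm_apply]
    have hrej : (s, k) ∈ rejected L (Beats (P.proposals hK)) S := by
      by_cases h : ∃ j, (s, j) ∈ S \ rejected L (Beats (P.proposals hK)) S
      · obtain ⟨j, hj⟩ := h
        have := hpref _ ((P.matchingOf_eq_some_iff hK hS).2 ⟨j, hj, rfl⟩)
        rw [P.rank_pref] at this
        exact hS.mem_rejected_of_lt (Finset.mem_sdiff.1 hj).1 (Fin.lt_def.2 this)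
      · have hnone := not_exists.1 h
        have := hnone k
        rw [Finset.mem_sdiff, not_and_not_right] at this
        exact this (hS.mem_of_none_accepted hnone k)
    have hle := (mem_rejected.1 hrej).2
    have hsk : P.proposals hK (s, k) = (u, P.score u s) := by
      simp [Market.proposals, hku]
    rcases huniv with h | ⟨s', hs', hbet⟩
    · rw [P.ncard_matchingOf hK hT hS] at h
      have : ({q ∈ S | Beats (P.proposals hK) q (s, k)} : Finset _).card
          ≤ ({p ∈ S | (P.proposals hK p).1 = u} : Finset _).card := by
        apply Finset.card_le_card
        intro q hq
        rw [Finset.mem_filter] at hq ⊢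
        exact ⟨hq.1, by rw [hq.2.1, hsk]⟩
      omega
    · obtain ⟨j, hj, hju⟩ := (P.matchingOf_eq_some_iff hK hS).1 hs'
      have hsj : P.proposals hK (s', j) = (u, P.score u s') := by
        simp [Market.proposals, hju]
      have hB : Beats (P.proposals hK) (s, k) (s', j) := by
        rw [Beats, hsk, hsj]
        exact ⟨rfl, hbet⟩
      rw [Finset.mem_sdiff, mem_rejected] at hj
      refine hj.2 ⟨hj.1, hle.trans (Finset.card_le_card ?_)⟩
      intro q hq
      rw [Finset.mem_filter] at hq ⊢
      exact ⟨hq.1, (isRanking_beats hT).trans hq.2 hB⟩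

/-! ### Counting the proposals of each type -/

/-- The number of proposals of type `k` in `S`. -/
noncomputable def typeCount {ι : Type*} (typ : ι → Fin K) (S : Finset ι) (k : Fin K) : ℕ :=
  ({p ∈ S | typ p = k} : Finset ι).card

theorem typeCount_mono {ι : Type*} (typ : ι → Fin K) {S T : Finset ι} (h : S ⊆ T) (k : Fin K) :
    typeCount typ S k ≤ typeCount typ T k :=
  Finset.card_le_card (Finset.filter_subset_filter _ h)

theorem sum_typeCount {ι : Type*} (typ : ι → Fin K) (S : Finset ι) :
    ∑ k, typeCount typ S k = S.card :=
  (Finset.card_eq_sum_card_fiberwise (f := typ) (t := Finset.univ) (by simp)).symm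

theorem typeCount_map {ι ι' : Type*} {typ : ι → Fin K} {typ' : ι' → Fin K} (e : ι ↪ ι')
    (he : ∀ p, typ' (e p) = typ p) (S : Finset ι) (k : Fin K) :
    typeCount typ' (S.map e) k = typeCount typ S k := by
  unfold typeCount
  rw [Finset.filter_map, Finset.card_map]
  simp only [Function.comp_def, he]

theorem typeCount_snd (S : Finset (Fin n × Fin K)) (k : Fin K) :
    typeCount Prod.snd S k = ({s | (s, k) ∈ S} : Finset (Fin n)).card := by
  unfold typeCount
  rw [← Finset.card_map ⟨fun s : Fin n => (s, k), fun a b h => (Prod.mk.inj h).1⟩]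
  congr 1
  ext ⟨s, j⟩
  simp only [Finset.mem_filter, Finset.mem_map, Finset.mem_univ, true_and]
  constructor
  · rintro ⟨h, rfl⟩; exact ⟨s, h, rfl⟩
  · rintro ⟨s', h, heq⟩
    obtain ⟨rfl, rfl⟩ := Prod.mk.inj (heq : (s', k) = (s, j))
    exact ⟨h, rfl⟩

theorem IsFinalState.typeCount_succ (hS : IsFinalState L B S) {i j : Fin K}
    (hij : (j : ℕ) = i + 1) :
    typeCount Prod.snd S j = typeCount Prod.snd (rejected L B S) i := by
  rw [typeCount_snd, typeCount_snd]
  congr 1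
  ext s
  simp only [Finset.mem_filter, Finset.mem_univ, true_and]
  rw [hS s j]
  constructor
  · rintro (h | ⟨i', h, hr⟩)
    · omega
    · have : i' = i := by ext; omega
      rwa [← this]
  · exact fun h => Or.inr ⟨i, hij, h⟩

theorem IsFinalState.typeCount_zero (hS : IsFinalState L B S) {i : Fin K}
    (hi : (i : ℕ) = 0) : typeCount Prod.snd S i = n := by
  rw [typeCount_snd]
  rw [Finset.filter_true_of_mem (fun s _ => (hS s i).2 (Or.inl hi)), Finset.card_univ,
    Fintype.card_fin]

/-- Those matched at position `i` have a proposal of type `i` that is not rejected, and the rejected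
ones of type `i` correspond to the proposals of type `i + 1`. -/
theorem Market.numMatched_matchingOf (P : Market n m) (hK : K ≤ m)
    (hS : IsFinalState L (Beats (P.proposals hK)) S) {i j : Fin K} (hij : (j : ℕ) = i + 1) :
    P.numMatched (P.matchingOf hK L S) i + typeCount Prod.snd S j = typeCount Prod.snd S i := by
  rw [hS.typeCount_succ hij, typeCount_snd, typeCount_snd]
  have : {s | ∃ u, P.matchingOf hK L S s = some u ∧ P.rank s u = i}
      = (({s | (s, i) ∈ S} : Finset (Fin n)) \
        ({s | (s, i) ∈ rejected L (Beats (P.proposals hK)) S} : Finset (Fin n)) :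
          Finset (Fin n)) := by
    ext s
    simp only [Set.mem_ofPred_eq, Finset.coe_sdiff, Finset.coe_filter, Finset.mem_univ, true_and,
      Set.mem_sdiff]
    rw [← Finset.mem_sdiff]
    constructor
    · rintro ⟨u, hu, hr⟩
      obtain ⟨k, hk, rfl⟩ := (P.matchingOf_eq_some_iff hK hS).1 hu
      rw [P.rank_pref] at hr
      rwa [← Fin.ext hr]
    · intro h
      exact ⟨_, (P.matchingOf_eq_some_iff hK hS).2 ⟨i, h, rfl⟩, P.rank_pref hK s i⟩
  rw [Market.numMatched, this, Set.ncard_coe_finset]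
  apply Finset.card_sdiff_add_card_eq_card
  intro s hs
  simp only [Finset.mem_filter, Finset.mem_univ, true_and] at hs ⊢
  exact rejected_subset hs

end FinalState

/-! ### Arrays of independent proposals -/

instance instIsProbabilityMeasureScoreLaw (D : Measure ℝ) [IsProbabilityMeasure D] :
    IsProbabilityMeasure (scoreLaw D) := by
  have : IsProbabilityMeasure (volume.restrict (Set.Icc (0 : ℝ) 1)) := ⟨by simp⟩
  unfold scoreLaw
  infer_instance

/-- The law of a proposal of type `k`: the university is uniformly random and the score
independent of it. -/
noncomputable def entryLaw (m : ℕ) (D D' : Measure ℝ) (k : ℕ) : Measure (Fin m × (ℝ × ℝ)) :=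
  (uniformOn (Set.univ : Set (Fin m))).prod (scoreLaw (if k = 0 then D else D'))

/-- The law of an array of independent proposals of prescribed types. -/
noncomputable def arrayLaw (m : ℕ) (D D' : Measure ℝ) {ι : Type*} [Fintype ι] {K : ℕ}
    (typ : ι → Fin K) : Measure (ι → Fin m × (ℝ × ℝ)) :=
  Measure.pi fun p => entryLaw m D D' (typ p)

section ArrayLaw

variable {m K : ℕ} {D D' : Measure ℝ} [IsProbabilityMeasure D] [IsProbabilityMeasure D']
  {ι : Type*} [Fintype ι]

instance instIsProbabilityMeasureScoreLawIte (k : ℕ) :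
    IsProbabilityMeasure (scoreLaw (if k = 0 then D else D')) := by
  split_ifs <;> infer_instance

instance instIsProbabilityMeasureUniformOnFin [NeZero m] :
    IsProbabilityMeasure (uniformOn (Set.univ : Set (Fin m))) :=
  isProbabilityMeasure_uniformOn Set.finite_univ Set.univ_nonempty

instance instIsProbabilityMeasureEntryLaw [NeZero m] (k : ℕ) :
    IsProbabilityMeasure (entryLaw m D D' k) := by
  unfold entryLaw
  infer_instance

instance instIsProbabilityMeasureArrayLaw [NeZero m] (typ : ι → Fin K) :
    IsProbabilityMeasure (arrayLaw m D D' typ) := by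
  unfold arrayLaw
  infer_instance

theorem measurableSet_better : MeasurableSet {x : (ℝ × ℝ) × (ℝ × ℝ) | Better x.1 x.2} := by
  change MeasurableSet ({x : (ℝ × ℝ) × (ℝ × ℝ) | x.2.1 < x.1.1} ∪
    ({x | x.2.1 = x.1.1} ∩ {x | x.2.2 < x.1.2}))
  exact (measurableSet_lt (by fun_prop) (by fun_prop)).union
    ((measurableSet_eq_fun (by fun_prop) (by fun_prop)).inter
      (measurableSet_lt (by fun_prop) (by fun_prop)))

omit [Fintype ι] in
theorem measurable_beats : Measurable fun d : ι → Fin m × (ℝ × ℝ) => Beats d := by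
  rw [measurable_pi_iff]
  intro q
  rw [measurable_pi_iff]
  intro p
  rw [← measurableSet_setOfPred]
  apply MeasurableSet.inter
  · exact measurableSet_eq_fun (by fun_prop) (by fun_prop)
  · exact (show Measurable fun d : ι → Fin m × (ℝ × ℝ) => ((d q).2, (d p).2) by fun_prop)
      measurableSet_better

omit [Fintype ι] in
theorem measurable_beatsOrTie (e : ι → ℕ) :
    Measurable fun d : ι → Fin m × (ℝ × ℝ) => BeatsOrTie e d := by
  rw [measurable_pi_iff]
  intro q
  rw [measurable_pi_iff]
  intro p
  rw [← measurableSet_setOfPred]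
  apply MeasurableSet.inter
  · exact measurableSet_eq_fun (by fun_prop) (by fun_prop)
  · apply MeasurableSet.union
    · exact (show Measurable fun d : ι → Fin m × (ℝ × ℝ) => ((d q).2, (d p).2) by fun_prop)
        measurableSet_better
    · exact (measurableSet_eq_fun (by fun_prop) (by fun_prop)).inter (MeasurableSet.const _)

/-- On a finite index set there are finitely many relations, so any function of the comparison
relation is measurable. -/
theorem measurable_of_beats {X : Type*} [MeasurableSpace X] (G : (ι → ι → Prop) → X) :
    Measurable fun d : ι → Fin m × (ℝ × ℝ) => G (Beats d) :=
  (Measurable.of_discrete (f := G)).comp measurable_beats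

theorem measurableSet_tieFree : MeasurableSet {d : ι → Fin m × (ℝ × ℝ) | TieFree d} := by
  have : {d : ι → Fin m × (ℝ × ℝ) | TieFree d}
      = ⋂ p, ⋂ q, ⋂ _ : p ≠ q, {d | (d p).2 = (d q).2}ᶜ := by
    ext d
    simp [TieFree]
  rw [this]
  refine MeasurableSet.iInter fun p => MeasurableSet.iInter fun q => MeasurableSet.iInter fun _ =>
    (measurableSet_eq_fun (by fun_prop) (by fun_prop)).compl

/-- The uniform tie-breakers have no atoms, so two independent scores almost surely differ, whatever
atoms `D` and `D'` have. -/
theorem ae_tieFree [NeZero m] (typ : ι → Fin K) : ∀ᵐ d ∂arrayLaw m D D' typ, TieFree d := by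
  unfold TieFree
  rw [ae_all_iff]
  intro p
  rw [ae_all_iff]
  intro q
  by_cases hpq : p = q
  · exact ae_of_all _ fun _ h => absurd hpq h
  have hind : IndepFun (fun d : ι → Fin m × (ℝ × ℝ) => d p) (fun d => d q)
      (arrayLaw m D D' typ) :=
    (iIndepFun_pi (μ := fun p => entryLaw m D D' (typ p)) (X := fun _ a => a)
      (fun i => aemeasurable_id)).indepFun hpq
  rw [indepFun_iff_map_prod_eq_prod_map_map (measurable_pi_apply p).aemeasurable
    (measurable_pi_apply q).aemeasurable] at hind
  have hev : ∀ r, (arrayLaw m D D' typ).map (fun d => d r) = entryLaw m D D' (typ r) := fun r =>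
    (measurePreserving_eval (fun p => entryLaw m D D' (typ p)) r).map_eq
  rw [hev, hev] at hind
  have hnull : ((entryLaw m D D' (typ p)).prod (entryLaw m D D' (typ q)))
      {x | x.1.2 = x.2.2} = 0 := by
    rw [Measure.measure_prod_null (measurableSet_eq_fun (by fun_prop) (by fun_prop))]
    refine ae_of_all _ fun a => ?_
    have : (Prod.mk a ⁻¹' {x : (Fin m × (ℝ × ℝ)) × (Fin m × (ℝ × ℝ)) | x.1.2 = x.2.2})
        = Set.univ ×ˢ {a.2} := by
      ext b
      simp [eq_comm]
    change entryLaw m D D' (typ q) (Prod.mk a ⁻¹' _) = 0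
    rw [this, entryLaw, Measure.prod_prod]
    have h2 : ({a.2} : Set (ℝ × ℝ)) = {a.2.1} ×ˢ {a.2.2} := by simp
    rw [h2, scoreLaw, Measure.prod_prod]
    simp
  rw [← hind, Measure.map_apply (by fun_prop)
    (measurableSet_eq_fun (by fun_prop) (by fun_prop))] at hnull
  filter_upwards [compl_mem_ae_iff.2 hnull] with d hd _ h
  exact hd h

/-! ### The mean number of rejections -/

/-- The expected number of rejected proposals of type `k` when `X i` proposals of type `i` are
made for every `i`. -/
noncomputable def meanRejected (m : ℕ) (D D' : Measure ℝ) (L : ℕ) {K : ℕ} (X : Fin K → ℕ)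
    (k : Fin K) : ℝ :=
  ∫ d, (typeCount Sigma.fst (rejected L (Beats d) Finset.univ) k : ℝ)
    ∂arrayLaw m D D' (Sigma.fst : (Σ i : Fin K, Fin (X i)) → Fin K)

theorem typeCount_le_card {ι : Type*} (typ : ι → Fin K) (S : Finset ι) (k : Fin K) :
    typeCount typ S k ≤ S.card := Finset.card_filter_le _ _

omit [Fintype ι] in
theorem abs_typeCount_rejected_le (typ : ι → Fin K) (L : ℕ) (B : ι → ι → Prop) (S : Finset ι)
    (k : Fin K) : |(typeCount typ (rejected L B S) k : ℝ)| ≤ S.card := by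
  rw [Nat.abs_cast, Nat.cast_le]
  exact (typeCount_le_card _ _ _).trans (Finset.card_le_card rejected_subset)

theorem integrable_typeCount_rejected [NeZero m] (typ : ι → Fin K) (L : ℕ) (S : Finset ι)
    (k : Fin K) : Integrable (fun d => (typeCount typ (rejected L (Beats d) S) k : ℝ))
      (arrayLaw m D D' typ) :=
  integrable_of_abs_le (measurable_of_beats fun B => (typeCount typ (rejected L B S) k : ℝ))
    fun _ => abs_typeCount_rejected_le _ _ _ _ _

omit [Fintype ι] in
theorem exists_embedding_of_typeCount (typ : ι → Fin K) (S : Finset ι) :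
    ∃ φ : (Σ i : Fin K, Fin (typeCount typ S i)) ↪ ι, (∀ p, typ (φ p) = p.1) ∧
      Finset.univ.map φ = S := by
  classical
  let φ : (Σ i : Fin K, Fin (typeCount typ S i)) → ι := fun p =>
    (((S.filter fun q => typ q = p.1).equivFin.symm p.2 : (S.filter fun q => typ q = p.1)) : ι)
  have hφ : ∀ p, φ p ∈ S ∧ typ (φ p) = p.1 := fun p =>
    Finset.mem_filter.1 ((S.filter fun q => typ q = p.1).equivFin.symm p.2).2
  have hinj : Function.Injective φ := by
    rintro ⟨i, a⟩ ⟨j, b⟩ h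
    have hij : i = j := (hφ ⟨i, a⟩).2.symm.trans ((congrArg typ h).trans (hφ ⟨j, b⟩).2)
    subst hij
    exact congrArg (Sigma.mk i) ((Equiv.injective _) (Subtype.ext h))
  refine ⟨⟨φ, hinj⟩, fun p => (hφ p).2, ?_⟩
  apply Finset.eq_of_subset_of_card_le
  · intro q hq
    obtain ⟨p, -, rfl⟩ := Finset.mem_map.1 hq
    exact (hφ p).1
  · rw [Finset.card_map, Finset.card_univ, Fintype.card_sigma]
    simp only [Fintype.card_fin]
    rw [sum_typeCount]

/-- The entries are independent with laws determined by their types, so the mean depends on `S` only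
through its type counts. -/
theorem integral_typeCount_rejected [NeZero m] (typ : ι → Fin K) (L : ℕ) (S : Finset ι)
    (k : Fin K) : ∫ d, (typeCount typ (rejected L (Beats d) S) k : ℝ) ∂arrayLaw m D D' typ
      = meanRejected m D D' L (typeCount typ S) k := by
  obtain ⟨φ, hφ, hS⟩ := exists_embedding_of_typeCount typ S
  have hmp := measurePreserving_pi_precomp (fun p => entryLaw m D D' (typ p)) φ.injective
  simp only [hφ] at hmp
  have h : ∀ d : ι → Fin m × (ℝ × ℝ), typeCount typ (rejected L (Beats d) S) k
      = typeCount Sigma.fst (rejected L (Beats fun p => d (φ p)) Finset.univ) k := by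
    intro d
    rw [← typeCount_map φ hφ, ← rejected_map (B := Beats fun p => d (φ p)) (B' := Beats d) φ (fun _ _ => Iff.rfl), hS]
  simp only [h]
  rw [meanRejected, arrayLaw, arrayLaw, ← hmp.map_eq, integral_map hmp.aemeasurable]
  exact (measurable_of_beats fun B =>
    (typeCount Sigma.fst (rejected L B Finset.univ) k : ℝ)).aestronglyMeasurable

/-- Accepted proposals are those made minus those rejected. This turns the system for `y` into `X
(i+1) ≈ meanRejected X i` for the rounded counts; `⌊·⌋₊` supplies the truncation at 0. -/
theorem acceptedRate_mul [NeZero m] {n : ℕ} (hn : n ≠ 0) (L : ℕ) (x : Fin K → ℝ) (i : Fin K) :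
    acceptedRate n m D D' L x i * n
      = ⌊x i * n⌋₊ - meanRejected m D D' L (fun i => ⌊x i * n⌋₊) i := by
  classical
  have hn' : (n : ℝ) ≠ 0 := Nat.cast_ne_zero.2 hn
  have hcard : ∀ d : Proposal n x → Fin m × (ℝ × ℝ),
      ({p : Proposal n x | p.1 = i ∧ Accepted L d p}.ncard : ℝ)
        = ⌊x i * n⌋₊ - (typeCount Sigma.fst (rejected L (Beats d) Finset.univ) i : ℝ) := by
    intro d
    rw [eq_sub_iff_add_eq, ← Nat.cast_add, Nat.cast_inj]
    have h1 : {p : Proposal n x | p.1 = i ∧ Accepted L d p}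
        = ((Finset.univ.filter fun p : Proposal n x => p.1 = i ∧ Accepted L d p) :
          Finset (Proposal n x)) := by
      ext; simp
    have h2 : (rejected L (Beats d) Finset.univ).filter (fun p => p.1 = i)
        = Finset.univ.filter fun p : Proposal n x => p.1 = i ∧ ¬ Accepted L d p := by
      ext p
      simp only [Finset.mem_filter, mem_rejected, Finset.mem_univ, true_and, Accepted, not_lt]
      rw [and_comm, ← Set.ncard_coe_finset, Finset.coe_filter]
      simp only [Finset.mem_univ, true_and]
      rfl
    have h3 : (Finset.univ.filter fun p : Proposal n x => p.1 = i).card = ⌊x i * n⌋₊ := by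
      have : (Finset.univ.filter fun p : Proposal n x => p.1 = i)
          = Finset.univ.map (Function.Embedding.sigmaMk i) := by
        ext ⟨j, a⟩
        simp only [Finset.mem_filter, Finset.mem_univ, true_and, Finset.mem_map,
          Function.Embedding.sigmaMk_apply]
        constructor
        · rintro rfl; exact ⟨a, rfl⟩
        · rintro ⟨b, hb⟩; exact (congrArg Sigma.fst hb).symm
      rw [this, Finset.card_map, Finset.card_univ, Fintype.card_fin]
    rw [h1, Set.ncard_coe_finset]
    unfold typeCount
    convert h3 using 1
    convert Finset.card_filter_add_card_filter_not
      (s := Finset.univ.filter fun p : Proposal n x => p.1 = i) (fun p => Accepted L d p) using 3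
    · rw [Finset.filter_filter]
    · rw [Finset.filter_filter]
      convert h2
  rw [acceptedRate, div_mul_cancel₀ _ hn']
  simp only [hcard]
  change ∫ d, _ ∂arrayLaw m D D' (Sigma.fst : (Σ i : Fin K, Fin ⌊x i * n⌋₊) → Fin K) = _
  rw [integral_sub (integrable_const _) (integrable_typeCount_rejected _ _ _ _)]
  simp [meanRejected]

omit [IsProbabilityMeasure D] [IsProbabilityMeasure D'] in
theorem meanRejected_nonneg (L : ℕ) (X : Fin K → ℕ) (k : Fin K) :
    0 ≤ meanRejected m D D' L X k :=
  integral_nonneg fun _ => Nat.cast_nonneg _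

/-! ### Concentration -/

omit [Fintype ι] in
open Classical in
theorem typeCount_le_add_sdiff (typ : ι → Fin K) {S T : Finset ι} (k : Fin K) :
    typeCount typ T k ≤ typeCount typ S k + (T \ S).card := by
  unfold typeCount
  refine le_trans (Finset.card_le_card (t := S.filter (fun p => typ p = k) ∪ (T \ S)) ?_)
    (Finset.card_union_le _ _)
  intro p hp
  rw [Finset.mem_filter] at hp
  by_cases h : p ∈ S
  · exact Finset.mem_union_left _ (Finset.mem_filter.2 ⟨h, hp.2⟩)
  · exact Finset.mem_union_right _ (Finset.mem_sdiff.2 ⟨hp.1, h⟩)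

omit [Fintype ι] in
open Classical in
theorem typeCount_rejected_le_erase {κ : Type*} {u : ι → κ} {B : ι → ι → Prop}
    (hB : IsRanking u B) (typ : ι → Fin K) (L : ℕ) (S : Finset ι) (p : ι) (k : Fin K) :
    typeCount typ (rejected L B S) k ≤ typeCount typ (rejected L B (S.erase p)) k + 1 := by
  by_cases hp : p ∈ S
  · refine (typeCount_le_add_sdiff typ (S := rejected L B (S.erase p)) k).trans ?_
    have h1 := card_rejected_insert_le (L := L) hB (Finset.notMem_erase p S)
    rw [Finset.insert_erase hp] at h1
    have h2 := Finset.card_sdiff_add_card_eq_card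
      (rejected_mono (L := L) (B := B) (Finset.erase_subset p S))
    omega
  · rw [Finset.erase_eq_of_notMem hp]
    omega

-- Changing entry `p` does not affect the rejections in `S.erase p`, and both counts exceed the
-- count there by 0 or 1. With `BeatsOrTie` this holds for every array, tied ones included, as the
-- bounded differences inequality requires.
omit [Fintype ι] in
open Classical in
theorem abs_typeCount_rejected_update_sub_le {e : ι → ℕ} (he : e.Injective)
    (typ : ι → Fin K) (L : ℕ) (S : Finset ι) (k : Fin K) (d : ι → Fin m × (ℝ × ℝ)) (p : ι)
    (a : Fin m × (ℝ × ℝ)) :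
    |(typeCount typ (rejected L (BeatsOrTie e (Function.update d p a)) S) k : ℝ)
      - typeCount typ (rejected L (BeatsOrTie e d) S) k| ≤ 1 := by
  have h1 := typeCount_rejected_le_erase (isRanking_beatsOrTie he d) typ L S p k
  have h2 := typeCount_rejected_le_erase (isRanking_beatsOrTie he (Function.update d p a))
    typ L S p k
  have h3 : rejected L (BeatsOrTie e (Function.update d p a)) (S.erase p)
      = rejected L (BeatsOrTie e d) (S.erase p) := by
    apply rejected_congr
    intro q hq r hr
    unfold BeatsOrTie
    rw [Function.update_of_ne (Finset.ne_of_mem_erase hq),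
      Function.update_of_ne (Finset.ne_of_mem_erase hr)]
  have h4 := typeCount_mono typ (rejected_mono (L := L) (B := BeatsOrTie e d)
    (Finset.erase_subset p S)) k
  have h5 := typeCount_mono typ (rejected_mono (L := L)
    (B := BeatsOrTie e (Function.update d p a)) (Finset.erase_subset p S)) k
  rw [h3] at h2 h5
  rw [abs_le]
  constructor
  · rw [neg_le_sub_iff_le_add]; exact_mod_cast by omega
  · rw [sub_le_iff_le_add]; exact_mod_cast by omega

theorem measureReal_abs_sub_meanRejected_le [NeZero m] (typ : ι → Fin K) (L : ℕ) (S : Finset ι)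
    (k : Fin K) {ε : ℝ} (hε : 0 ≤ ε) :
    (arrayLaw m D D' typ).real {d | ε ≤ |(typeCount typ (rejected L (Beats d) S) k : ℝ)
        - meanRejected m D D' L (typeCount typ S) k|}
      ≤ 2 * Real.exp (-ε ^ 2 / (2 * Fintype.card ι)) := by
  classical
  set e : ι → ℕ := fun p => Fintype.equivFin ι p with hedef
  have he : e.Injective := fun a b h => (Fintype.equivFin ι).injective (Fin.ext h)
  set f : (ι → Fin m × (ℝ × ℝ)) → ℝ :=
    fun d => typeCount typ (rejected L (BeatsOrTie e d) S) k with hf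
  have hfm : Measurable f :=
    (Measurable.of_discrete (f := fun B : ι → ι → Prop =>
      (typeCount typ (rejected L B S) k : ℝ))).comp (measurable_beatsOrTie e)
  have hsub := hasSubgaussianMGF_of_bounded_differences (fun p => entryLaw m D D' (typ p)) f hfm
    S.card (fun d => abs_typeCount_rejected_le _ _ _ _ _)
    (abs_typeCount_rejected_update_sub_le he typ L S k)
  -- Ties are null, so the estimate for `BeatsOrTie` carries over to `Beats`, mean included.
  have hae : ∀ᵐ d ∂arrayLaw m D D' typ,
      f d = (typeCount typ (rejected L (Beats d) S) k : ℝ) := by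
    filter_upwards [ae_tieFree typ] with d hd
    rw [hf]
    simp only [beatsOrTie_eq_beats e hd]
  have hmean : ∫ d, f d ∂arrayLaw m D D' typ = meanRejected m D D' L (typeCount typ S) k := by
    rw [integral_congr_ae hae, integral_typeCount_rejected]
  change HasSubgaussianMGF (fun d => f d - ∫ d', f d' ∂arrayLaw m D D' typ) _
    (arrayLaw m D D' typ) at hsub
  rw [hmean] at hsub
  have h1 := hsub.measure_ge_le hε
  have h2 := hsub.neg.measure_ge_le hε
  set r := meanRejected m D D' L (typeCount typ S) k
  have h3 : (arrayLaw m D D' typ).real {d | ε ≤ |(typeCount typ (rejected L (Beats d) S) k : ℝ) - r|}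
      ≤ (arrayLaw m D D' typ).real ({d | ε ≤ f d - r} ∪ {d | ε ≤ (-fun d => f d - r) d}) := by
    refine ENNReal.toReal_mono (measure_ne_top _ _) (measure_mono_ae ?_)
    filter_upwards [hae] with d hd
    intro (h : ε ≤ |(typeCount typ (rejected L (Beats d) S) k : ℝ) - r|)
    rw [← hd, le_abs] at h
    exact h
  refine h3.trans ((measureReal_union_le _ _).trans ?_)
  simp only [NNReal.coe_natCast] at h1 h2
  linarith

end ArrayLaw

/-! ### The system of equations is contracting -/

section Contraction

variable {m K : ℕ} {D D' : Measure ℝ} [IsProbabilityMeasure D] [IsProbabilityMeasure D']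
  {ι : Type*} [Fintype ι]

theorem uniformOn_univ_real_singleton [NeZero m] (u : Fin m) :
    (uniformOn (Set.univ : Set (Fin m))).real {u} = 1 / m := by
  rw [Measure.real, uniformOn_univ]
  simp

theorem entryLaw_real_prod_univ [NeZero m] (k : ℕ) (U : Set (Fin m)) :
    (entryLaw m D D' k).real (U ×ˢ Set.univ) = (uniformOn (Set.univ : Set (Fin m))).real U := by
  rw [entryLaw, measureReal_prod_prod]
  simp

/-- Split according to the university `u` of `p`: it is `u` with probability `1 / m`, and each
member of `S` independently avoids `u` with probability `1 - 1 / m`. -/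
theorem pow_le_measureReal_fresh [NeZero m] (typ : ι → Fin K) {S : Finset ι} {p : ι}
    (hp : p ∉ S) : (1 - 1 / (m : ℝ)) ^ S.card
      ≤ (arrayLaw m D D' typ).real {d | ∀ q ∈ S, (d q).1 ≠ (d p).1} := by
  classical
  let A : Fin m → ι → Set (Fin m × (ℝ × ℝ)) := fun u q =>
    if q = p then {u} ×ˢ Set.univ else if q ∈ S then {u}ᶜ ×ˢ Set.univ else Set.univ
  have hA : ∀ u, (arrayLaw m D D' typ).real (Set.univ.pi (A u))
      = 1 / m * (1 - 1 / (m : ℝ)) ^ S.card := by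
    intro u
    rw [arrayLaw, Measure.real, Measure.pi_pi, ENNReal.toReal_prod]
    have h1 : ∀ q, (entryLaw m D D' (typ q) (A u q)).toReal
        = (if q = p then 1 / (m : ℝ) else 1) * (if q ∈ S then 1 - 1 / (m : ℝ) else 1) := by
      intro q
      change (entryLaw m D D' (typ q)).real _ = _
      simp only [A]
      by_cases hq : q = p
      · subst hq
        rw [if_pos rfl, if_pos rfl, if_neg hp, entryLaw_real_prod_univ,
          uniformOn_univ_real_singleton, mul_one]
      · rw [if_neg hq, if_neg hq, one_mul]
        by_cases hqS : q ∈ S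
        · rw [if_pos hqS, if_pos hqS, entryLaw_real_prod_univ,
            probReal_compl_eq_one_sub (MeasurableSet.singleton u), uniformOn_univ_real_singleton]
        · rw [if_neg hqS, if_neg hqS]
          simp
    simp only [h1]
    rw [Finset.prod_mul_distrib]
    congr 1
    · simp
    · rw [Finset.prod_ite]
      simp
  have hdisj : Set.PairwiseDisjoint (↑(Finset.univ : Finset (Fin m)))
      fun u => Set.univ.pi (A u) := by
    intro u _ v _ huv
    rw [Function.onFun, Set.disjoint_left]
    intro d hd hd'
    have h1 := hd p (Set.mem_univ _)
    have h2 := hd' p (Set.mem_univ _)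
    simp only [A, if_true, Set.mem_prod, Set.mem_singleton_iff] at h1 h2
    exact huv (h1.1.symm.trans h2.1)
  have hmeas : ∀ u, MeasurableSet (Set.univ.pi (A u)) := by
    intro u
    refine MeasurableSet.univ_pi fun q => ?_
    simp only [A]
    split_ifs
    · exact (MeasurableSet.singleton u).prod MeasurableSet.univ
    · exact (MeasurableSet.singleton u).compl.prod MeasurableSet.univ
    · exact MeasurableSet.univ
  have hsub : (⋃ u ∈ (Finset.univ : Finset (Fin m)), Set.univ.pi (A u))
      ⊆ {d | ∀ q ∈ S, (d q).1 ≠ (d p).1} := by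
    intro d hd q hq
    simp only [Finset.mem_univ, Set.iUnion_true, Set.mem_iUnion] at hd
    obtain ⟨u, hd⟩ := hd
    have h1 := hd p (Set.mem_univ _)
    have h2 := hd q (Set.mem_univ _)
    have hqp : q ≠ p := fun h => hp (h ▸ hq)
    simp only [A, if_true, if_neg hqp, if_pos hq, Set.mem_prod, Set.mem_singleton_iff,
      Set.mem_compl_iff] at h1 h2
    rw [h1.1]
    exact h2.1
  refine le_trans ?_ (measureReal_mono hsub)
  rw [measureReal_biUnion_finset hdisj fun u _ => hmeas u]
  simp only [hA]
  have hm : (m : ℝ) ≠ 0 := Nat.cast_ne_zero.2 (NeZero.ne m)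
  simp only [Finset.sum_const, Finset.card_univ, Fintype.card_fin, nsmul_eq_mul]
  rw [← mul_assoc, mul_one_div_cancel hm, one_mul]

theorem sum_meanRejected_eq [NeZero m] (typ : ι → Fin K) (L : ℕ) (S : Finset ι) :
    ∑ k, meanRejected m D D' L (typeCount typ S) k
      = ∫ d, ((rejected L (Beats d) S).card : ℝ) ∂arrayLaw m D D' typ := by
  simp only [← integral_typeCount_rejected]
  rw [← integral_finsetSum _ fun k _ => integrable_typeCount_rejected typ L S k]
  refine integral_congr_ae (ae_of_all _ fun d => ?_)
  change ∑ k, (typeCount typ (rejected L (Beats d) S) k : ℝ) = ((rejected L (Beats d) S).card : ℝ)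
  rw [← sum_typeCount typ (rejected L (Beats d) S)]
  push_cast
  rfl

theorem integrable_card_rejected [NeZero m] (typ : ι → Fin K) (L : ℕ) (S : Finset ι) :
    Integrable (fun d => ((rejected L (Beats d) S).card : ℝ)) (arrayLaw m D D' typ) :=
  integrable_of_abs_le (measurable_of_beats fun B => ((rejected L B S).card : ℝ))
    (C := S.card) fun d => by
      rw [Nat.abs_cast, Nat.cast_le]
      exact Finset.card_le_card rejected_subset

-- One more proposal adds at most one rejection, and none if no member of `S` goes to the same
-- university.
open Classical in
theorem sum_meanRejected_insert_le [NeZero m] (typ : ι → Fin K) {L : ℕ} (hL : 1 ≤ L)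
    {S : Finset ι} {p : ι} (hp : p ∉ S) :
    ∑ k, meanRejected m D D' L (typeCount typ (insert p S)) k
      ≤ ∑ k, meanRejected m D D' L (typeCount typ S) k + (1 - (1 - 1 / (m : ℝ)) ^ S.card) := by
  rw [sum_meanRejected_eq, sum_meanRejected_eq]
  set F : Set (ι → Fin m × (ℝ × ℝ)) := {d | ∀ q ∈ S, (d q).1 ≠ (d p).1}
  have hF : MeasurableSet F := by
    have : F = ⋂ q ∈ S, {d | (d q).1 = (d p).1}ᶜ := by
      ext d; simp [F]
    rw [this]
    exact Finset.measurableSet_biInter _ fun q _ =>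
      (measurableSet_eq_fun (by fun_prop) (by fun_prop)).compl
  have hint : Integrable (F.indicator fun _ => (1 : ℝ)) (arrayLaw m D D' typ) :=
    (integrable_const _).indicator hF
  have hint' : Integrable (fun d => 1 - F.indicator (fun _ => (1 : ℝ)) d) (arrayLaw m D D' typ) :=
    (integrable_const _).sub hint
  have hle : ∫ d, ((rejected L (Beats d) (insert p S)).card : ℝ) ∂arrayLaw m D D' typ
      ≤ ∫ d, (((rejected L (Beats d) S).card : ℝ) + (1 - F.indicator (fun _ => (1 : ℝ)) d))
        ∂arrayLaw m D D' typ := by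
    refine integral_mono_ae (integrable_card_rejected typ L _)
      ((integrable_card_rejected typ L S).add hint') ?_
    filter_upwards [ae_tieFree typ] with d hd
    by_cases hdF : d ∈ F
    · rw [Set.indicator_of_mem hdF, rejected_insert_of_fresh (isRanking_beats hd) hL hdF]
      simp
    · rw [Set.indicator_of_notMem hdF, sub_zero]
      exact_mod_cast card_rejected_insert_le (isRanking_beats hd) hp
  rw [integral_add (integrable_card_rejected typ L S) hint',
    integral_sub (integrable_const _) hint, integral_indicator_const _ hF] at hle
  have := pow_le_measureReal_fresh (m := m) (D := D) (D' := D') typ hp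
  simp only [integral_const, probReal_univ, smul_eq_mul, mul_one] at hle
  linarith

theorem meanRejected_mono [NeZero m] (typ : ι → Fin K) (L : ℕ) {S T : Finset ι} (h : S ⊆ T)
    (k : Fin K) :
    meanRejected m D D' L (typeCount typ S) k ≤ meanRejected m D D' L (typeCount typ T) k := by
  rw [← integral_typeCount_rejected, ← integral_typeCount_rejected]
  exact integral_mono (integrable_typeCount_rejected typ L S k)
    (integrable_typeCount_rejected typ L T k)
    fun d => Nat.cast_le.2 (typeCount_mono typ (rejected_mono h) k)

/-- The proposals in `T \ S` are added one at a time; the exponent `Fintype.card ι` bounds the size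
of every intermediate set. -/
theorem sum_meanRejected_le_of_subset [NeZero m] (typ : ι → Fin K) {L : ℕ} (hL : 1 ≤ L)
    {S T : Finset ι} (hST : S ⊆ T) :
    ∑ k, meanRejected m D D' L (typeCount typ T) k
      ≤ ∑ k, meanRejected m D D' L (typeCount typ S) k
        + (1 - (1 - 1 / (m : ℝ)) ^ Fintype.card ι) * (T.card - S.card : ℝ) := by
  classical
  have hm : (1 : ℝ) ≤ m := Nat.one_le_cast.2 (NeZero.one_le)
  have h0 : 0 ≤ 1 - 1 / (m : ℝ) := by
    rw [sub_nonneg, div_le_one (by linarith)]; exact hm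
  have h1 : 1 - 1 / (m : ℝ) ≤ 1 := by
    have : 0 ≤ 1 / (m : ℝ) := by positivity
    linarith
  have key : ∀ U : Finset ι, Disjoint S U →
      ∑ k, meanRejected m D D' L (typeCount typ (S ∪ U)) k
        ≤ ∑ k, meanRejected m D D' L (typeCount typ S) k
          + (1 - (1 - 1 / (m : ℝ)) ^ Fintype.card ι) * U.card := by
    intro U
    induction U using Finset.induction_on with
    | empty => intro _; simp
    | insert p U hpU ih =>
      intro hd
      rw [Finset.disjoint_insert_right] at hd
      have hp : p ∉ S ∪ U := by simp [hd.1, hpU]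
      have h2 := sum_meanRejected_insert_le (m := m) (D := D) (D' := D') typ hL hp
      have h3 : (1 - 1 / (m : ℝ)) ^ Fintype.card ι ≤ (1 - 1 / (m : ℝ)) ^ (S ∪ U).card :=
        pow_le_pow_of_le_one h0 h1 (Finset.card_le_univ _)
      have h4 := ih hd.2
      rw [Finset.union_insert, Finset.card_insert_of_notMem hpU]
      push_cast
      linarith
  have h2 := key (T \ S) Finset.disjoint_sdiff
  rw [Finset.union_sdiff_of_subset hST] at h2
  have h3 := Finset.card_sdiff_add_card_eq_card hST
  have h4 : ((T \ S).card : ℝ) = T.card - S.card := by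
    rw [← h3]; push_cast; ring
  rwa [h4] at h2

/-- For nested sets all differences have the same sign, so ℓ¹ distances are differences of totals.
-/
theorem sum_abs_meanRejected_sub_le_of_subset [NeZero m] (typ : ι → Fin K) {L : ℕ} (hL : 1 ≤ L)
    {S T : Finset ι} (hST : S ⊆ T) :
    ∑ k, |meanRejected m D D' L (typeCount typ T) k - meanRejected m D D' L (typeCount typ S) k|
      ≤ (1 - (1 - 1 / (m : ℝ)) ^ Fintype.card ι) *
        ∑ k, |(typeCount typ T k : ℝ) - typeCount typ S k| := by
  have h1 : ∀ k, |meanRejected m D D' L (typeCount typ T) k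
      - meanRejected m D D' L (typeCount typ S) k|
      = meanRejected m D D' L (typeCount typ T) k - meanRejected m D D' L (typeCount typ S) k :=
    fun k => abs_of_nonneg (sub_nonneg.2 (meanRejected_mono typ L hST k))
  have h2 : ∀ k, |(typeCount typ T k : ℝ) - typeCount typ S k|
      = (typeCount typ T k : ℝ) - typeCount typ S k :=
    fun k => abs_of_nonneg (sub_nonneg.2 (Nat.cast_le.2 (typeCount_mono typ hST k)))
  simp only [h1, h2, Finset.sum_sub_distrib]
  have h3 := sum_meanRejected_le_of_subset (m := m) (D := D) (D' := D') typ hL hST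
  rw [← Nat.cast_sum, ← Nat.cast_sum, sum_typeCount, sum_typeCount]
  linarith

theorem typeCount_initial {N : ℕ} {X : Fin K → ℕ} (hX : ∀ i, X i ≤ N) :
    typeCount Prod.snd (({p | (p.1 : ℕ) < X p.2} : Finset (Fin N × Fin K))) = X := by
  funext k
  rw [typeCount_snd]
  simp only [Finset.mem_filter, Finset.mem_univ, true_and]
  rw [Fin.card_filter_val_lt]
  exact min_eq_right (hX k)

/-- The map taking numbers of proposals to mean numbers of rejections contracts distances. -/
theorem sum_abs_meanRejected_sub_le [NeZero m] {L N : ℕ} (hL : 1 ≤ L) {X Y : Fin K → ℕ}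
    (hX : ∀ i, X i ≤ N) (hY : ∀ i, Y i ≤ N) :
    ∑ k, |meanRejected m D D' L X k - meanRejected m D D' L Y k|
      ≤ (1 - (1 - 1 / (m : ℝ)) ^ (N * K)) * ∑ k, |(X k : ℝ) - Y k| := by
  have haux : ∀ {W Z : Fin K → ℕ}, (∀ i, W i ≤ Z i) → (∀ i, Z i ≤ N) →
      ∑ k, |meanRejected m D D' L Z k - meanRejected m D D' L W k|
        ≤ (1 - (1 - 1 / (m : ℝ)) ^ (N * K)) * ∑ k, |(Z k : ℝ) - W k| := by
    intro W Z hWZ hZ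
    have := sum_abs_meanRejected_sub_le_of_subset (m := m) (D := D) (D' := D')
      (Prod.snd : Fin N × Fin K → Fin K) hL
      (S := ({p | (p.1 : ℕ) < W p.2} : Finset (Fin N × Fin K)))
      (T := ({p | (p.1 : ℕ) < Z p.2} : Finset (Fin N × Fin K)))
      (fun p hp => by
        simp only [Finset.mem_filter, Finset.mem_univ, true_and] at hp ⊢
        exact hp.trans_le (hWZ _))
    rwa [typeCount_initial hZ, typeCount_initial fun i => (hWZ i).trans (hZ i),
      Fintype.card_prod, Fintype.card_fin, Fintype.card_fin] at this
  -- Incomparable vectors are compared through their coordinatewise minimum, which loses nothing: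
  -- the ℓ¹ distances to it add up to the distance of `X` and `Y`.
  have h1 := haux (W := fun i => min (X i) (Y i)) (fun i => min_le_left _ _) hX
  have h2 := haux (W := fun i => min (X i) (Y i)) (fun i => min_le_right _ _) hY
  have h3 : ∀ k, |(X k : ℝ) - (min (X k) (Y k) : ℕ)| + |(Y k : ℝ) - (min (X k) (Y k) : ℕ)|
      = |(X k : ℝ) - Y k| := by
    intro k
    rcases le_total (X k) (Y k) with h | h
    · rw [min_eq_left h, sub_self, abs_zero, zero_add, abs_sub_comm]
    · rw [min_eq_right h, sub_self, abs_zero, add_zero]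
  calc ∑ k, |meanRejected m D D' L X k - meanRejected m D D' L Y k|
      ≤ ∑ k, (|meanRejected m D D' L X k - meanRejected m D D' L (fun i => min (X i) (Y i)) k|
          + |meanRejected m D D' L Y k - meanRejected m D D' L (fun i => min (X i) (Y i)) k|) := by
        refine Finset.sum_le_sum fun k _ => ?_
        rw [abs_sub_comm (meanRejected m D D' L Y k)]
        exact abs_sub_le _ _ _
    _ ≤ (1 - (1 - 1 / (m : ℝ)) ^ (N * K)) * ∑ k, |(X k : ℝ) - (min (X k) (Y k) : ℕ)|
          + (1 - (1 - 1 / (m : ℝ)) ^ (N * K)) * ∑ k, |(Y k : ℝ) - (min (X k) (Y k) : ℕ)| := by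
        rw [Finset.sum_add_distrib]
        exact add_le_add h1 h2
    _ = _ := by
        rw [← mul_add, ← Finset.sum_add_distrib]
        simp only [h3]

end Contraction

/-! ### The expected number of final states -/

section FirstMoment

open Classical

variable {n m K L : ℕ} {D D' : Measure ℝ} [IsProbabilityMeasure D] [IsProbabilityMeasure D']

theorem exists_perm_initial (T : Finset (Fin n)) :
    ∃ σ : Equiv.Perm (Fin n), ∀ i, σ i ∈ T ↔ (i : ℕ) < T.card := by
  have hcard : Fintype.card {i : Fin n // (i : ℕ) < T.card} = Fintype.card {i // i ∈ T} := by
    rw [Fintype.card_subtype, Fin.card_filter_val_lt, Fintype.card_coe]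
    exact min_eq_right ((Finset.card_le_univ T).trans (Fintype.card_fin n).le)
  let e := Fintype.equivOfCardEq hcard
  refine ⟨e.extendSubtype, fun i => ⟨fun h => ?_, fun h => e.extendSubtype_mem i h⟩⟩
  by_contra hi
  exact e.extendSubtype_not_mem i hi h

/-- A permutation moving an initial segment onto `T`. -/
noncomputable def initialPerm (T : Finset (Fin n)) : Equiv.Perm (Fin n) :=
  (exists_perm_initial T).choose

theorem initialPerm_mem (T : Finset (Fin n)) (i : Fin n) :
    initialPerm T i ∈ T ↔ (i : ℕ) < T.card := (exists_perm_initial T).choose_spec i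

/-- The students whose proposal of type `k` is in `S`. -/
noncomputable def row (S : Finset (Fin n × Fin K)) (k : Fin K) : Finset (Fin n) :=
  {s | (s, k) ∈ S}

theorem mem_row {S : Finset (Fin n × Fin K)} {k : Fin K} {s : Fin n} :
    s ∈ row S k ↔ (s, k) ∈ S := by simp [row]

/-- The type-preserving permutation of all proposals that moves initial segments onto the rows of
`S`. -/
noncomputable def proposalPerm (S : Finset (Fin n × Fin K)) : Equiv.Perm (Fin n × Fin K) where
  toFun p := (initialPerm (row S p.2) p.1, p.2)
  invFun p := ((initialPerm (row S p.2)).symm p.1, p.2)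
  left_inv p := by simp
  right_inv p := by simp

/-- The first `X k` proposals of type `k`, for every `k`. -/
noncomputable def initial (n : ℕ) (X : Fin K → ℕ) : Finset (Fin n × Fin K) :=
  {p | (p.1 : ℕ) < X p.2}

theorem initial_map_proposalPerm (S : Finset (Fin n × Fin K)) :
    (initial n (typeCount Prod.snd S)).map (proposalPerm S).toEmbedding = S := by
  ext p
  rw [Finset.mem_map_equiv, initial, Finset.mem_filter]
  simp only [Finset.mem_univ, true_and]
  rw [typeCount_snd]
  change (((initialPerm (row S p.2)).symm p.1 : Fin n) : ℕ) < (row S p.2).card ↔ _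
  rw [← initialPerm_mem, Equiv.apply_symm_apply, mem_row]

/-- Read in the order of `S`, the array has in `S` the rejections that the original has in the
initial segments, up to a permutation. Those in the initial segments depend on `S` only through its
counts. -/
theorem rejected_comp_proposalPerm_symm (d : Fin n × Fin K → Fin m × (ℝ × ℝ))
    (S : Finset (Fin n × Fin K)) :
    rejected L (Beats fun p => d ((proposalPerm S).symm p)) S
      = (rejected L (Beats d) (initial n (typeCount Prod.snd S))).map
        (proposalPerm S).toEmbedding := by
  conv_lhs => rw [← initial_map_proposalPerm S]
  rw [initial_map_proposalPerm]
  nth_rw 2 [← initial_map_proposalPerm S]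
  apply rejected_map
  intro a b
  simp [Beats]

theorem IsFinalState.row_zero {B : Fin n × Fin K → Fin n × Fin K → Prop}
    {S : Finset (Fin n × Fin K)} (hS : IsFinalState L B S) {k : Fin K} (hk : (k : ℕ) = 0) :
    row S k = Finset.univ := by
  ext s
  rw [mem_row]
  simp [(hS s k).2 (Or.inl hk)]

theorem IsFinalState.mem_row_succ {B : Fin n × Fin K → Fin n × Fin K → Prop}
    {S : Finset (Fin n × Fin K)} (hS : IsFinalState L B S) {j k : Fin K} (hk : (k : ℕ) = j + 1)
    {s : Fin n} : s ∈ row S k ↔ (s, j) ∈ rejected L B S := by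
  rw [mem_row, hS s k]
  constructor
  · rintro (h | ⟨i, h, hr⟩)
    · omega
    · obtain rfl : i = j := by ext; omega
      exact hr
  · exact fun h => Or.inr ⟨j, hk, h⟩

/-- A final state can be recovered from its numbers of proposals and the array read in its
order. -/
theorem IsFinalState.eq_of_typeCount_eq {d : Fin n × Fin K → Fin m × (ℝ × ℝ)}
    {S T : Finset (Fin n × Fin K)}
    (hS : IsFinalState L (Beats fun p => d ((proposalPerm S).symm p)) S)
    (hT : IsFinalState L (Beats fun p => d ((proposalPerm T).symm p)) T)
    (hST : typeCount Prod.snd S = typeCount Prod.snd T) : S = T := by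
  -- Row `k` fixes the reading order for type `k`; together with the common rejections in the
  -- initial segments it determines the rejected proposals of type `k`, which form row `k + 1`.
  have hrow : ∀ k, row S k = row T k := by
    rintro ⟨k, hk⟩
    induction k with
    | zero => rw [hS.row_zero rfl, hT.row_zero rfl]
    | succ k ih =>
      have ih := ih (by omega)
      ext s
      rw [hS.mem_row_succ (j := ⟨k, by omega⟩) rfl, hT.mem_row_succ (j := ⟨k, by omega⟩) rfl,
        rejected_comp_proposalPerm_symm, rejected_comp_proposalPerm_symm, Finset.mem_map_equiv,
        Finset.mem_map_equiv, hST]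
      change ((initialPerm (row S ⟨k, _⟩)).symm s, _) ∈ _ ↔
        ((initialPerm (row T ⟨k, _⟩)).symm s, _) ∈ _
      rw [ih]
  ext ⟨s, k⟩
  rw [← mem_row, hrow, mem_row]

theorem measurableSet_isFinalState (S : Finset (Fin n × Fin K)) :
    MeasurableSet {d : Fin n × Fin K → Fin m × (ℝ × ℝ) | IsFinalState L (Beats d) S} :=
  measurableSet_setOfPred.2 (measurable_of_beats fun B => IsFinalState L B S)

/-- The event `A S` that `S` is final is as likely as the event `A' S` that `S` is final for the
array read in the order of `S`. The events `A' S` are disjoint for sets with the same counts, and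
each forces the rejections in the initial segments to have the numbers prescribed by `X`. -/
theorem measureReal_exists_isFinalState_le [NeZero m] (X : Fin K → ℕ) :
    (arrayLaw m D D' (Prod.snd : Fin n × Fin K → Fin K)).real
        {d | ∃ S, IsFinalState L (Beats d) S ∧ typeCount Prod.snd S = X}
      ≤ (arrayLaw m D D' (Prod.snd : Fin n × Fin K → Fin K)).real
        {d | ∀ i j : Fin K, (j : ℕ) = i + 1 →
          typeCount Prod.snd (rejected L (Beats d) (initial n X)) i = X j} := by
  set Q := arrayLaw m D D' (Prod.snd : Fin n × Fin K → Fin K)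
  let 𝒮 : Finset (Finset (Fin n × Fin K)) := {S | typeCount Prod.snd S = X}
  let A : Finset (Fin n × Fin K) → Set (Fin n × Fin K → Fin m × (ℝ × ℝ)) :=
    fun S => {d | IsFinalState L (Beats d) S}
  let A' : Finset (Fin n × Fin K) → Set (Fin n × Fin K → Fin m × (ℝ × ℝ)) :=
    fun S => {d | IsFinalState L (Beats fun p => d ((proposalPerm S).symm p)) S}
  have hpre : ∀ S, MeasurePreserving
      (fun (d : Fin n × Fin K → Fin m × (ℝ × ℝ)) p => d ((proposalPerm S).symm p)) Q Q :=
    fun S => measurePreserving_pi_precomp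
      (fun p : Fin n × Fin K => entryLaw m D D' p.2) (proposalPerm S).symm.injective
  have hA' : ∀ S, Q.real (A' S) = Q.real (A S) := fun S =>
    (hpre S).measureReal_preimage (measurableSet_isFinalState S).nullMeasurableSet
  have hA'm : ∀ S, MeasurableSet (A' S) := fun S =>
    (hpre S).measurable (measurableSet_isFinalState S)
  have hdisj : Set.PairwiseDisjoint (↑𝒮) A' := by
    intro S hS T hT hne
    rw [Function.onFun, Set.disjoint_left]
    intro d hd hd'
    simp only [𝒮, Finset.coe_filter, Finset.mem_univ, true_and, Set.mem_ofPred_eq] at hS hT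
    exact hne (IsFinalState.eq_of_typeCount_eq hd hd' (hS.trans hT.symm))
  calc Q.real {d | ∃ S, IsFinalState L (Beats d) S ∧ typeCount Prod.snd S = X}
      ≤ Q.real (⋃ S ∈ 𝒮, A S) := by
        refine measureReal_mono ?_ (measure_ne_top _ _)
        rintro d ⟨S, hS, hX⟩
        simp only [Set.mem_iUnion]
        exact ⟨S, by simp [𝒮, hX], hS⟩
    _ ≤ ∑ S ∈ 𝒮, Q.real (A S) := measureReal_biUnion_finset_le _ _
    _ = ∑ S ∈ 𝒮, Q.real (A' S) := by simp only [hA']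
    -- Disjointness turns the sum over exponentially many sets back into a single probability.
    _ = Q.real (⋃ S ∈ 𝒮, A' S) := (measureReal_biUnion_finset hdisj fun S _ => hA'm S).symm
    _ ≤ _ := by
        refine measureReal_mono ?_ (measure_ne_top _ _)
        intro d hd i j hij
        simp only [Set.mem_iUnion] at hd
        obtain ⟨S, hS, hd⟩ := hd
        have hd : IsFinalState L (Beats fun p => d ((proposalPerm S).symm p)) S := hd
        obtain rfl : typeCount Prod.snd S = X := by simpa [𝒮] using hS
        rw [hd.typeCount_succ hij, rejected_comp_proposalPerm_symm]
        exact (typeCount_map (typ := Prod.snd) (typ' := Prod.snd)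
          (proposalPerm S).toEmbedding (fun _ => rfl) _ _).symm

/-- A union bound over the `(n + 1) ^ K` possible count vectors; for `ε` of order `n` the
exponential beats this polynomial factor. -/
theorem measureReal_exists_isFinalState_abs_sub_le [NeZero m] {ε : ℝ} (hε : 0 ≤ ε) :
    (arrayLaw m D D' (Prod.snd : Fin n × Fin K → Fin K)).real
        {d | ∃ S, IsFinalState L (Beats d) S ∧ ∃ i j : Fin K, (j : ℕ) = i + 1 ∧
          ε ≤ |(typeCount Prod.snd S j : ℝ) - meanRejected m D D' L (typeCount Prod.snd S) i|}
      ≤ (n + 1) ^ K * (2 * Real.exp (-ε ^ 2 / (2 * (n * K)))) := by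
  set Q := arrayLaw m D D' (Prod.snd : Fin n × Fin K → Fin K)
  let F : (Fin K → Fin (n + 1)) → Set (Fin n × Fin K → Fin m × (ℝ × ℝ)) := fun X =>
    {d | (∃ S, IsFinalState L (Beats d) S ∧ typeCount Prod.snd S = fun k => (X k : ℕ)) ∧
      ∃ i j : Fin K, (j : ℕ) = i + 1 ∧
        ε ≤ |((X j : ℕ) : ℝ) - meanRejected m D D' L (fun k => (X k : ℕ)) i|}
  have hF : ∀ X, Q.real (F X) ≤ 2 * Real.exp (-ε ^ 2 / (2 * (n * K))) := by
    intro X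
    by_cases h : ∃ i j : Fin K, (j : ℕ) = i + 1 ∧
        ε ≤ |((X j : ℕ) : ℝ) - meanRejected m D D' L (fun k => (X k : ℕ)) i|
    · obtain ⟨i, j, hij, hX⟩ := h
      have h1 : Q.real (F X) ≤ _ := (measureReal_mono fun d hd => hd.1).trans
        (measureReal_exists_isFinalState_le (L := L) (D := D) (D' := D') (n := n)
          fun k => (X k : ℕ))
      refine h1.trans (le_trans (measureReal_mono ?_) (le_of_le_of_eq
        (measureReal_abs_sub_meanRejected_le (Prod.snd : Fin n × Fin K → Fin K) L
          (initial n fun k => (X k : ℕ)) i hε) ?_))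
      · intro d hd
        have hle : ∀ k, (X k : ℕ) ≤ n := fun k => Nat.lt_succ_iff.1 (X k).2
        change ε ≤ |_|
        rw [hd i j hij, initial, typeCount_initial hle]
        exact hX
      · simp
    · have : F X = ∅ := by
        ext d
        exact ⟨fun hd => absurd hd.2 h, fun hd => absurd hd (Set.notMem_empty d)⟩
      rw [this, measureReal_empty]
      positivity
  calc _ ≤ Q.real (⋃ X ∈ (Finset.univ : Finset (Fin K → Fin (n + 1))), F X) := by
        refine measureReal_mono ?_ (measure_ne_top _ _)
        rintro d ⟨S, hS, hex⟩
        simp only [Finset.mem_univ, Set.iUnion_true, Set.mem_iUnion]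
        have hle : ∀ k, typeCount Prod.snd S k < n + 1 := by
          intro k
          rw [typeCount_snd, Nat.lt_succ_iff]
          exact (Finset.card_le_univ _).trans (Fintype.card_fin n).le
        exact ⟨fun k => ⟨typeCount Prod.snd S k, hle k⟩, ⟨S, hS, rfl⟩, hex⟩
    _ ≤ ∑ X : Fin K → Fin (n + 1), Q.real (F X) := measureReal_biUnion_finset_le _ _
    _ ≤ ∑ _X : Fin K → Fin (n + 1), 2 * Real.exp (-ε ^ 2 / (2 * (n * K))) :=
        Finset.sum_le_sum fun X _ => hF X
    _ = _ := by simp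

end FirstMoment

/-! ### Comparison of the lists with independent choices -/

section Comparison

open scoped ENNReal

variable {n m K : ℕ} {D D' : Measure ℝ} [IsProbabilityMeasure D] [IsProbabilityMeasure D']

instance instMeasurableSingletonClassPerm (m : ℕ) : DiscreteMeasurableSpace (Equiv.Perm (Fin m)) :=
  ⟨fun _ => trivial⟩

instance instIsProbabilityMeasureUniformOnPerm (m : ℕ) :
    IsProbabilityMeasure (uniformOn (Set.univ : Set (Equiv.Perm (Fin m)))) :=
  isProbabilityMeasure_uniformOn Set.finite_univ Set.univ_nonempty

/-- Left multiplication by a permutation shows that all injective prefixes have equally many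
extensions, and there are `m.descFactorial K` such prefixes. -/
theorem card_perm_extending (hK : K ≤ m) {w : Fin K → Fin m} (hw : w.Injective) :
    Fintype.card {σ : Equiv.Perm (Fin m) // ∀ k, σ (Fin.castLE hK k) = w k} * m.descFactorial K
      = m.factorial := by
  classical
  have hsame : ∀ v : Fin K ↪ Fin m,
      Fintype.card {σ : Equiv.Perm (Fin m) // ∀ k, σ (Fin.castLE hK k) = v k}
        = Fintype.card {σ : Equiv.Perm (Fin m) // ∀ k, σ (Fin.castLE hK k) = w k} := by
    intro v
    obtain ⟨g, hg⟩ := Equiv.Perm.exists_extending_pair v w v.injective hw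
    refine Fintype.card_congr ((Equiv.mulLeft g).subtypeEquiv fun σ => forall_congr' fun k => ?_)
    rw [Equiv.coe_mulLeft, Equiv.Perm.mul_apply, ← hg k]
    exact g.injective.eq_iff.symm
  let e : Equiv.Perm (Fin m) ≃
      Σ v : Fin K ↪ Fin m, {σ : Equiv.Perm (Fin m) // ∀ k, σ (Fin.castLE hK k) = v k} :=
    { toFun := fun σ => ⟨(Fin.castLEEmb hK).trans σ.toEmbedding, σ, fun _ => rfl⟩
      invFun := fun x => x.2.1
      left_inv := fun _ => rfl
      right_inv := by
        rintro ⟨v, σ, h⟩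
        obtain rfl : (Fin.castLEEmb hK).trans σ.toEmbedding = v := by
          ext k; exact congrArg Fin.val (h k)
        rfl }
  have h1 := Fintype.card_congr e
  rw [Fintype.card_sigma, Fintype.card_perm, Fintype.card_fin] at h1
  simp only [hsame] at h1
  rw [Finset.sum_const, Finset.card_univ, Fintype.card_embedding_eq, Fintype.card_fin,
    Fintype.card_fin, smul_eq_mul, mul_comm] at h1
  exact h1.symm

theorem uniformOn_perm_extending_le (hK : K ≤ m) (w : Fin K → Fin m) :
    uniformOn (Set.univ : Set (Equiv.Perm (Fin m))) {σ | ∀ k, σ (Fin.castLE hK k) = w k}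
      ≤ (m.descFactorial K : ℝ≥0∞)⁻¹ := by
  classical
  by_cases hw : w.Injective
  · have h := card_perm_extending hK hw
    have hd : m.descFactorial K ≠ 0 := (Nat.descFactorial_pos.2 hK).ne'
    rw [uniformOn_univ, Fintype.card_perm, Fintype.card_fin,
      Measure.count_apply_finite _ (Set.toFinite _), Set.Finite.card_toFinset, ← h]
    rw [Nat.cast_mul]
    refine ENNReal.div_le_of_le_mul ?_
    rw [mul_comm ((Fintype.card _ : ℕ) : ℝ≥0∞), ← mul_assoc,
      ENNReal.inv_mul_cancel (by exact_mod_cast hd) (ENNReal.natCast_ne_top _), one_mul]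
    exact le_of_eq (by congr)
  · have : {σ : Equiv.Perm (Fin m) | ∀ k, σ (Fin.castLE hK k) = w k} = ∅ := by
      rw [Set.eq_empty_iff_forall_notMem]
      intro σ hσ
      apply hw
      intro a b hab
      have := σ.injective ((hσ a).trans (hab.trans (hσ b).symm))
      exact Fin.castLE_injective hK this
    rw [this]
    simp

theorem arrayLaw_eq_sum [NeZero m] {B : Set (Fin n × Fin K → Fin m × (ℝ × ℝ))}
    (hB : MeasurableSet B) :
    arrayLaw m D D' (Prod.snd : Fin n × Fin K → Fin K) B
      = ∑ v : Fin n × Fin K → Fin m, (Measure.pi fun p : Fin n × Fin K =>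
        scoreLaw (if (p.2 : ℕ) = 0 then D else D')) {x | (fun p => (v p, x p)) ∈ B}
          * ((m : ℝ≥0∞)⁻¹) ^ (n * K) := by
  have hmp := measurePreserving_arrowProdEquivProdArrow (Fin m) (ℝ × ℝ) (Fin n × Fin K)
    (fun _ => uniformOn (Set.univ : Set (Fin m)))
    (fun p => scoreLaw (if (p.2 : ℕ) = 0 then D else D'))
  have h1 := hmp.symm.measure_preimage hB.nullMeasurableSet
  rw [arrayLaw]
  unfold entryLaw
  rw [← h1, Measure.prod_apply (hmp.symm.measurable hB), lintegral_fintype]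
  refine Finset.sum_congr rfl fun v _ => ?_
  congr 1
  rw [Measure.pi_singleton]
  simp only [uniformOn_univ, Measure.count_singleton, Fintype.card_fin]
  simp

/-- The law of the scores in different places of the table. -/
theorem measurePreserving_scores {v : Fin n × Fin K → Fin m}
    (hv : ∀ s j k, v (s, j) = v (s, k) → j = k) :
    MeasurePreserving (fun (z : Fin m → Fin n → (ℝ × ℝ) × (ℝ × ℝ)) (p : Fin n × Fin K) =>
        if (p.2 : ℕ) = 0 then (z (v p) p.1).1 else (z (v p) p.1).2)
      (Measure.pi fun _ : Fin m => Measure.pi fun _ : Fin n => (scoreLaw D).prod (scoreLaw D'))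
      (Measure.pi fun p : Fin n × Fin K => scoreLaw (if (p.2 : ℕ) = 0 then D else D')) := by
  set ρ := (scoreLaw D).prod (scoreLaw D') with hρ
  have h1 : MeasurePreserving (MeasurableEquiv.curry (Fin m) (Fin n) ((ℝ × ℝ) × (ℝ × ℝ))).symm
      (Measure.pi fun _ : Fin m => Measure.pi fun _ : Fin n => ρ)
      (Measure.pi fun _ : Fin m × Fin n => ρ) := by
    refine ⟨MeasurableEquiv.measurable _, ?_⟩
    have := Measure.infinitePi_map_curry_symm (fun (_ : Fin m) (_ : Fin n) => ρ)
    simpa only [Measure.infinitePi_eq_pi] using this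
  -- A student's list has no repetitions, so different proposals read different cells of the score
  -- table and their scores are independent.
  have hinj : Function.Injective fun p : Fin n × Fin K => (v p, p.1) := by
    rintro ⟨s, j⟩ ⟨s', k⟩ h
    obtain ⟨h1, h2⟩ := Prod.mk.inj h
    obtain rfl : s = s' := h2
    rw [hv s j k h1]
  have h2 := measurePreserving_pi_precomp (fun _ : Fin m × Fin n => ρ) hinj
  let sel : Fin n × Fin K → (ℝ × ℝ) × (ℝ × ℝ) → ℝ × ℝ :=
    fun p x => if (p.2 : ℕ) = 0 then x.1 else x.2
  have hselm : ∀ p, Measurable (sel p) := by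
    intro p
    simp only [sel]
    split_ifs
    · exact measurable_fst
    · exact measurable_snd
  have hsel : ∀ p, ρ.map (sel p) = scoreLaw (if (p.2 : ℕ) = 0 then D else D') := by
    intro p
    by_cases h : (p.2 : ℕ) = 0
    · have : sel p = Prod.fst := by funext x; simp [sel, h]
      rw [this, if_pos h]
      exact measurePreserving_fst.map_eq
    · have : sel p = Prod.snd := by funext x; simp [sel, h]
      rw [this, if_neg h]
      exact measurePreserving_snd.map_eq
  have h3 : MeasurePreserving (fun (x : Fin n × Fin K → (ℝ × ℝ) × (ℝ × ℝ)) p => sel p (x p))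
      (Measure.pi fun _ => ρ)
      (Measure.pi fun p : Fin n × Fin K => scoreLaw (if (p.2 : ℕ) = 0 then D else D')) := by
    refine ⟨measurable_pi_iff.2 fun p => (hselm p).comp (measurable_pi_apply p), ?_⟩
    have : ∀ p, IsProbabilityMeasure (ρ.map (sel p)) := fun p => by rw [hsel]; infer_instance
    rw [Measure.pi_map_pi fun p => (hselm p).aemeasurable]
    simp only [hsel]
  exact h3.comp (h2.comp h1)

theorem market_proposals (hK : K ≤ m) (ω : Sample n m) (p : Fin n × Fin K) :
    (market ω).proposals hK p = (ω.1 p.1 (Fin.castLE hK p.2),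
      if (p.2 : ℕ) = 0 then (ω.2 (ω.1 p.1 (Fin.castLE hK p.2)) p.1).1
        else (ω.2 (ω.1 p.1 (Fin.castLE hK p.2)) p.1).2) := by
  simp [Market.proposals, market]

theorem measurable_market_proposals (hK : K ≤ m) :
    Measurable fun ω : Sample n m => (market ω).proposals hK := by
  have : (fun ω : Sample n m => (market ω).proposals hK) = fun ω p =>
      (fun u : Fin m => (u, if (p.2 : ℕ) = 0 then (ω.2 u p.1).1 else (ω.2 u p.1).2))
        (ω.1 p.1 (Fin.castLE hK p.2)) := by
    funext ω p
    exact market_proposals hK ω p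
  rw [this]
  refine measurable_pi_iff.2 fun p => ?_
  have hu : Measurable fun ω : Sample n m => ω.1 p.1 (Fin.castLE hK p.2) :=
    (Measurable.of_discrete (f := fun σ : Equiv.Perm (Fin m) => σ (Fin.castLE hK p.2))).comp
      ((measurable_pi_apply p.1).comp measurable_fst)
  have hG : Measurable fun x : Fin m × (Fin m → Fin n → (ℝ × ℝ) × (ℝ × ℝ)) =>
      (x.1, if (p.2 : ℕ) = 0 then (x.2 x.1 p.1).1 else (x.2 x.1 p.1).2) := by
    refine measurable_from_prod_countable_right fun u => ?_
    split_ifs <;> fun_prop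
  exact hG.comp (hu.prodMk measurable_snd)

/-- The first `K` entries of the lists, with their scores, have a density of at most
`(m ^ K / m.descFactorial K) ^ n` with respect to independent proposals. -/
theorem sampleLaw_proposals_le [NeZero m] (hK : K ≤ m)
    {B : Set (Fin n × Fin K → Fin m × (ℝ × ℝ))} (hB : MeasurableSet B) :
    sampleLaw n m D D' {ω | (market ω).proposals hK ∈ B}
      ≤ (((m : ℝ≥0∞) ^ K / m.descFactorial K) ^ n) *
        arrayLaw m D D' (Prod.snd : Fin n × Fin K → Fin K) B := by
  classical
  set P := Measure.pi fun _ : Fin n => uniformOn (Set.univ : Set (Equiv.Perm (Fin m))) with hP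
  set ν := Measure.pi fun _ : Fin m => Measure.pi fun _ : Fin n => (scoreLaw D).prod (scoreLaw D')
    with hν
  let first : (Fin n → Equiv.Perm (Fin m)) → Fin n × Fin K → Fin m :=
    fun π p => π p.1 (Fin.castLE hK p.2)
  let h : (Fin n × Fin K → Fin m) → ℝ≥0∞ := fun v =>
    (Measure.pi fun p : Fin n × Fin K => scoreLaw (if (p.2 : ℕ) = 0 then D else D'))
      {x | (fun p => (v p, x p)) ∈ B}
  have hfirst : Measurable first := Measurable.of_discrete
  -- Given the lists, the scores have exactly the law they have in an independent array, so only the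
  -- laws of the chosen universities differ.
  have hfib : ∀ π : Fin n → Equiv.Perm (Fin m),
      ν (Prod.mk π ⁻¹' {ω : Sample n m | (market ω).proposals hK ∈ B}) = h (first π) := by
    intro π
    have hmp := measurePreserving_scores (D := D) (D' := D') (v := first π) (by
      intro s j k hjk
      exact Fin.castLE_injective hK ((π s).injective hjk))
    have hset : MeasurableSet {x : Fin n × Fin K → ℝ × ℝ | (fun p => (first π p, x p)) ∈ B} :=
      (show Measurable fun (x : Fin n × Fin K → ℝ × ℝ) p => (first π p, x p) by fun_prop) hB
    change _ = (Measure.pi _) _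
    rw [← hmp.measure_preimage hset.nullMeasurableSet]
    congr 1
    ext z
    change (market (π, z)).proposals hK ∈ B ↔ (fun p => (first π p, _)) ∈ B
    rw [show (market (π, z)).proposals hK = _ from funext (market_proposals hK (π, z))]
  have hsingle : ∀ v, (P.map first) {v} ≤ ((m.descFactorial K : ℝ≥0∞)⁻¹) ^ n := by
    intro v
    rw [Measure.map_apply hfirst (MeasurableSet.singleton v)]
    have : first ⁻¹' {v} = Set.univ.pi fun s =>
        {σ : Equiv.Perm (Fin m) | ∀ k, σ (Fin.castLE hK k) = v (s, k)} := by
      ext π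
      simp only [Set.mem_preimage, Set.mem_singleton_iff, Set.mem_univ_pi, Set.mem_ofPred_eq,
        first, funext_iff, Prod.forall]
    rw [this, hP, Measure.pi_pi]
    refine (Finset.prod_le_prod' fun s _ => uniformOn_perm_extending_le hK _).trans ?_
    simp
  have hmeas : MeasurableSet {ω : Sample n m | (market ω).proposals hK ∈ B} :=
    measurable_market_proposals hK hB
  have hm0 : (m : ℝ≥0∞) ≠ 0 := by exact_mod_cast NeZero.ne m
  have hmt : (m : ℝ≥0∞) ≠ ⊤ := ENNReal.natCast_ne_top m
  have hconst : ((m.descFactorial K : ℝ≥0∞)⁻¹) ^ n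
      = ((m : ℝ≥0∞) ^ K / m.descFactorial K) ^ n * ((m : ℝ≥0∞)⁻¹) ^ (n * K) := by
    rw [mul_comm n K, pow_mul, ← mul_pow, div_eq_mul_inv, mul_comm ((m : ℝ≥0∞) ^ K), mul_assoc,
      ← mul_pow, ENNReal.mul_inv_cancel hm0 hmt, one_pow, mul_one]
  calc sampleLaw n m D D' {ω | (market ω).proposals hK ∈ B}
      = ∫⁻ π, h (first π) ∂P := by
        rw [sampleLaw, Measure.prod_apply hmeas]
        simp only [← hν, hfib]
        rfl
    _ = ∑ v, h v * (P.map first) {v} := by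
        rw [← lintegral_map Measurable.of_discrete hfirst, lintegral_fintype]
    _ ≤ ∑ v, h v * ((m.descFactorial K : ℝ≥0∞)⁻¹) ^ n :=
        Finset.sum_le_sum fun v _ => mul_le_mul_right (hsingle v) _
    _ = _ := by
        rw [arrayLaw_eq_sum hB, hconst, Finset.mul_sum]
        refine Finset.sum_congr rfl fun v _ => ?_
        simp only [h]
        ring

end Comparison

/-! ### Approximate solutions of the system -/

theorem exp_neg_two_mul_le {x : ℝ} (h0 : 0 ≤ x) (h1 : x ≤ 1 / 2) : Real.exp (-(2 * x)) ≤ 1 - x := by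
  have h2 := Real.add_one_le_exp (2 * x)
  rw [Real.exp_neg, inv_le_comm₀ (Real.exp_pos _) (by linarith)]
  refine le_trans ?_ h2
  rw [inv_le_iff_one_le_mul₀ (by linarith)]
  nlinarith

/-- Keeps the contraction factor away from 1 uniformly in `n`, since `m` is proportional to `n`. -/
theorem exp_le_one_sub_inv_pow {m n : ℕ} {M : ℝ} (hM : 0 < M) (hmn : (m : ℝ) = M * n)
    (hm : 2 ≤ m) (a : ℕ) : Real.exp (-(2 * a / M)) ≤ (1 - 1 / (m : ℝ)) ^ (n * a) := by
  have hm' : (2 : ℝ) ≤ m := by exact_mod_cast hm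
  have h := exp_neg_two_mul_le (x := 1 / (m : ℝ)) (by positivity)
    (one_div_le_one_div_of_le (by norm_num) hm')
  refine le_trans (le_of_eq ?_) (pow_le_pow_left₀ (Real.exp_pos _).le h _)
  rw [← Real.exp_nat_mul]
  congr 1
  have hn : (n : ℝ) ≠ 0 := by
    rintro h0
    rw [h0, mul_zero] at hmn
    linarith
  rw [hmn]
  push_cast
  field_simp

/-- Each student contributes a factor of at most `exp (2 * K ^ 2 / m)`, and there are `n = m / M`
students, so the density stays bounded as `n` grows. -/
theorem pow_div_descFactorial_pow_le {m n K : ℕ} {M : ℝ} (hM : 0 < M) (hmn : (m : ℝ) = M * n)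
    (hm : 1 ≤ m) (hK : 2 * K ≤ m) :
    ((m : ℝ) ^ K / m.descFactorial K) ^ n ≤ Real.exp (2 * K ^ 2 / M) := by
  have hm' : (1 : ℝ) ≤ m := by exact_mod_cast hm
  have hK' : (2 : ℝ) * K ≤ m := by exact_mod_cast hK
  have hd : 0 < m.descFactorial K := Nat.descFactorial_pos.2 (by omega)
  have hn : (n : ℝ) ≠ 0 := by
    rintro h0
    rw [h0, mul_zero] at hmn
    linarith
  have h := exp_neg_two_mul_le (x := (K : ℝ) / m) (by positivity)
    (by rw [div_le_iff₀ (by linarith)]; linarith)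
  have h1 : ((m : ℝ) * Real.exp (-(2 * (K / m)))) ^ K ≤ m.descFactorial K := by
    have h2 : (m : ℝ) * Real.exp (-(2 * (K / m))) ≤ ((m + 1 - K : ℕ) : ℝ) := by
      rw [Nat.cast_sub (by omega)]
      push_cast
      calc (m : ℝ) * Real.exp (-(2 * (K / m))) ≤ m * (1 - K / m) :=
            mul_le_mul_of_nonneg_left h (by linarith)
        _ = m - K := by field_simp
        _ ≤ _ := by linarith
    refine (pow_le_pow_left₀ (by positivity) h2 K).trans ?_
    exact_mod_cast Nat.pow_sub_le_descFactorial m K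
  have h3 : (m : ℝ) ^ K / m.descFactorial K ≤ Real.exp (2 * K ^ 2 / m) := by
    rw [div_le_iff₀ (by exact_mod_cast hd)]
    have h4 : (m : ℝ) ^ K = Real.exp (2 * K ^ 2 / m) * ((m : ℝ) * Real.exp (-(2 * (K / m)))) ^ K := by
      rw [mul_pow, ← Real.exp_nat_mul, mul_left_comm, ← Real.exp_add]
      have : 2 * (K : ℝ) ^ 2 / m + K * -(2 * (K / m)) = 0 := by ring
      rw [this, Real.exp_zero, mul_one]
    rw [h4]
    exact mul_le_mul_of_nonneg_left h1 (Real.exp_pos _).le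
  refine (pow_le_pow_left₀ (by positivity) h3 n).trans (le_of_eq ?_)
  rw [← Real.exp_nat_mul]
  congr 1
  rw [hmn]
  field_simp

section Solution

variable {m n K L : ℕ} {D D' : Measure ℝ} [IsProbabilityMeasure D] [IsProbabilityMeasure D']

omit [IsProbabilityMeasure D] [IsProbabilityMeasure D'] in
theorem acceptedRate_nonneg (x : Fin K → ℝ) (i : Fin K) :
    0 ≤ acceptedRate n m D D' L x i :=
  div_nonneg (integral_nonneg fun _ => Nat.cast_nonneg _) (Nat.cast_nonneg _)

theorem acceptedRate_le [NeZero m] (hn : n ≠ 0) (x : Fin K → ℝ) (i : Fin K) :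
    acceptedRate n m D D' L x i ≤ max 0 (x i) := by
  have hn' : (0 : ℝ) < n := by exact_mod_cast Nat.pos_of_ne_zero hn
  have h := acceptedRate_mul (D := D) (D' := D') (m := m) hn L x i
  have h1 := meanRejected_nonneg (m := m) (D := D) (D' := D') L (fun i => ⌊x i * n⌋₊) i
  refine le_of_mul_le_mul_right ?_ hn'
  rcases le_total 0 (x i) with hx | hx
  · rw [max_eq_right hx]
    have := Nat.floor_le (mul_nonneg hx hn'.le)
    linarith
  · rw [max_eq_left hx]
    have : ⌊x i * n⌋₊ = 0 := Nat.floor_of_nonpos (mul_nonpos_of_nonpos_of_nonneg hx hn'.le)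
    rw [this, Nat.cast_zero] at h
    linarith

/-- Two approximate solutions, in terms of numbers of proposals, are close. -/
theorem sum_abs_sub_le_of_approx [NeZero m] {N : ℕ} (hL : 1 ≤ L) {X Y : Fin K → ℕ}
    (hXN : ∀ i, X i ≤ N) (hYN : ∀ i, Y i ≤ N) {δ c : ℝ} (hc : 0 < c)
    (hcm : c ≤ (1 - 1 / (m : ℝ)) ^ (N * K))
    (h0 : ∀ i : Fin K, (i : ℕ) = 0 → |(X i : ℝ) - Y i| ≤ 2 * δ)
    (hX : ∀ i j : Fin K, (j : ℕ) = i + 1 → |(X j : ℝ) - meanRejected m D D' L X i| ≤ δ)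
    (hY : ∀ i j : Fin K, (j : ℕ) = i + 1 → |(Y j : ℝ) - meanRejected m D D' L Y i| ≤ δ) :
    ∑ k, |(X k : ℝ) - Y k| ≤ 2 * K * δ / c := by
  have hcon := sum_abs_meanRejected_sub_le (m := m) (D := D) (D' := D') hL hXN hYN
  set r := meanRejected m D D' L X
  set q := meanRejected m D D' L Y
  -- The first type contributes at most `2 * δ`, and each later one at most `2 * δ` plus the
  -- difference of mean rejections of the preceding type.
  have hs : ∑ k, |(X k : ℝ) - Y k| ≤ 2 * K * δ + ∑ k, |r k - q k| := by
    rcases K with _ | K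
    · simp
    · rw [Fin.sum_univ_succ]
      have h1 : ∀ k : Fin K, |(X k.succ : ℝ) - Y k.succ| ≤ 2 * δ + |r k.castSucc - q k.castSucc| := by
        intro k
        have h2 := hX k.castSucc k.succ (by simp)
        have h3 := hY k.castSucc k.succ (by simp)
        rw [abs_le] at h2 h3 ⊢
        have h4 := le_abs_self (r k.castSucc - q k.castSucc)
        have h5 := neg_abs_le (r k.castSucc - q k.castSucc)
        constructor <;> linarith
      have h6 := Finset.sum_le_sum fun k (_ : k ∈ Finset.univ) => h1 k
      rw [Finset.sum_add_distrib, Finset.sum_const, Finset.card_univ, Fintype.card_fin,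
        nsmul_eq_mul] at h6
      have h7 := h0 0 rfl
      rw [Fin.sum_univ_castSucc (fun k => |r k - q k|)]
      have h8 := abs_nonneg (r (Fin.last K) - q (Fin.last K))
      push_cast
      linarith
  have hnn : 0 ≤ ∑ k, |(X k : ℝ) - Y k| := Finset.sum_nonneg fun _ _ => abs_nonneg _
  -- With `s` the sum on the left, the contraction gives `s ≤ 2 * K * δ + (1 - c) * s`.
  rw [le_div_iff₀ hc]
  nlinarith

/-- The numbers of proposals belonging to a solution of the system solve it approximately. -/
theorem IsSolution.eventually_approx {n m : ℕ → ℕ} {y : ℕ → Fin K → ℝ}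
    (hy : IsSolution n m D D' L y) (hn : Tendsto n atTop atTop) (hm : ∀ᶠ t in atTop, 0 < m t)
    {δ : ℝ} (hδ : 0 < δ) :
    ∀ᶠ t in atTop, (∀ i, |((⌊y t i * n t⌋₊ : ℕ) : ℝ) - y t i * n t| ≤ δ * n t) ∧
      (∀ i, ⌊y t i * n t⌋₊ ≤ 2 * n t) ∧
      (∀ i : Fin K, (i : ℕ) = 0 → |(n t : ℝ) - (⌊y t i * n t⌋₊ : ℕ)| ≤ 2 * (δ * n t)) ∧
      ∀ i j : Fin K, (j : ℕ) = i + 1 → |((⌊y t j * n t⌋₊ : ℕ) : ℝ)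
        - meanRejected (m t) D D' L (fun i => ⌊y t i * n t⌋₊) i| ≤ δ * n t := by
  -- No bounds on `y` are assumed. They follow by induction from `0 ≤ f i y ≤ max 0 (y i)`, where
  -- `f` is the rate of acceptance: subtracting it neither raises `y i` nor takes it below `min 0 (y
  -- i)`.
  have hbound : ∀ k : Fin K, ∀ η : ℝ, 0 < η → ∀ᶠ t in atTop, -η ≤ y t k ∧ y t k ≤ 1 + η := by
    rintro ⟨k, hk⟩
    induction k with
    | zero =>
      intro η hη
      have h := (hy.1 ⟨0, hk⟩ rfl).eventually (Metric.closedBall_mem_nhds 1 hη)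
      filter_upwards [h] with t ht
      rw [Real.dist_eq, abs_le] at ht
      constructor <;> linarith
    | succ k ih =>
      intro η hη
      have h := (hy.2 ⟨k, by omega⟩ ⟨k + 1, hk⟩ rfl).eventually
        (Metric.closedBall_mem_nhds 0 (half_pos hη))
      filter_upwards [h, ih (by omega) (η / 2) (half_pos hη), hm, hn.eventually_gt_atTop 0]
        with t ht ht' hmt hnt
      have : NeZero (m t) := ⟨hmt.ne'⟩
      rw [Real.dist_eq, abs_le] at ht
      have h1 := acceptedRate_nonneg (n := n t) (m := m t) (D := D) (D' := D') (L := L) (y t)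
        ⟨k, by omega⟩
      have h2 := acceptedRate_le (n := n t) (m := m t) (D := D) (D' := D') (L := L) hnt.ne' (y t)
        ⟨k, by omega⟩
      rcases max_cases 0 (y t ⟨k, by omega⟩) with h3 | h3 <;> constructor <;> linarith
  -- The bound `δ / 6` controls the error of truncating negative `y i` to 0; the bound `1 / 2` keeps
  -- the counts below `2 * n`.
  have hδ3 : 0 < min (δ / 6) (1 / 2) := lt_min (by linarith) (by norm_num)
  have hsys : ∀ᶠ t in atTop, ∀ i j : Fin K, (j : ℕ) = i + 1 →
      |y t j - (y t i - acceptedRate (n t) (m t) D D' L (y t) i)| ≤ δ / 3 := by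
    rw [eventually_all]
    intro i
    rw [eventually_all]
    intro j
    by_cases hij : (j : ℕ) = i + 1
    · have h := (hy.2 i j hij).eventually (Metric.closedBall_mem_nhds 0 (by linarith : 0 < δ / 3))
      filter_upwards [h] with t ht _
      simpa [Real.dist_eq] using ht
    · exact Eventually.of_forall fun t h => absurd h hij
  have hzero : ∀ᶠ t in atTop, ∀ i : Fin K, (i : ℕ) = 0 → |y t i - 1| ≤ δ / 3 := by
    rw [eventually_all]
    intro i
    by_cases hi : (i : ℕ) = 0
    · have h := (hy.1 i hi).eventually (Metric.closedBall_mem_nhds 1 (by linarith : 0 < δ / 3))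
      filter_upwards [h] with t ht _
      simpa [Real.dist_eq] using ht
    · exact Eventually.of_forall fun t h => absurd h hi
  have hlarge : ∀ᶠ t in atTop, 6 / δ ≤ n t := (tendsto_natCast_atTop_atTop.comp hn).eventually_ge_atTop _
  filter_upwards [eventually_all.2 fun k => hbound k _ hδ3, hsys, hzero, hlarge, hm,
    hn.eventually_gt_atTop 0] with t hb hs hz hl hmt hnt
  have : NeZero (m t) := ⟨hmt.ne'⟩
  have hn0 : (0 : ℝ) < n t := by exact_mod_cast hnt
  have hl' : 1 ≤ δ / 6 * n t := by
    rw [div_le_iff₀ hδ] at hl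
    linarith
  have hm1 := min_le_left (δ / 6) (1 / 2)
  have hm2 := min_le_right (δ / 6) (1 / 2)
  have hfl : ∀ i, |((⌊y t i * n t⌋₊ : ℕ) : ℝ) - y t i * n t| ≤ δ / 6 * n t := by
    intro i
    rcases le_total 0 (y t i) with hyi | hyi
    · have h1 := Nat.floor_le (mul_nonneg hyi hn0.le)
      have h2 := Nat.lt_floor_add_one (y t i * n t)
      rw [abs_le]
      constructor <;> linarith
    · rw [Nat.floor_of_nonpos (mul_nonpos_of_nonpos_of_nonneg hyi hn0.le), Nat.cast_zero, zero_sub,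
        abs_neg, abs_mul, abs_of_nonpos hyi, abs_of_pos hn0]
      exact mul_le_mul_of_nonneg_right (by linarith [(hb i).1]) hn0.le
  refine ⟨fun i => (hfl i).trans (by nlinarith), fun i => ?_, fun i hi => ?_, fun i j hij => ?_⟩
  · apply Nat.floor_le_of_le
    push_cast
    exact mul_le_mul_of_nonneg_right (by linarith [(hb i).2]) hn0.le
  · have h1 := abs_le.1 (hfl i)
    have h2 := abs_le.1 (hz i hi)
    rw [abs_le]
    constructor <;> nlinarith
  · have h1 := abs_le.1 (hfl i)
    have h2 := abs_le.1 (hfl j)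
    have h3 := abs_le.1 (hs i j hij)
    have h4 := acceptedRate_mul (D := D) (D' := D') (m := m t) hnt.ne' L (y t) i
    have h5 : -(δ / 3 * n t) ≤ y t j * n t - (y t i * n t
        - acceptedRate (n t) (m t) D D' L (y t) i * n t) := by nlinarith
    have h6 : y t j * n t - (y t i * n t
        - acceptedRate (n t) (m t) D D' L (y t) i * n t) ≤ δ / 3 * n t := by nlinarith
    rw [h4] at h5 h6
    rw [abs_le]
    constructor <;> nlinarith

end Solution

/-! ### Stable matchings close to a solution -/

open scoped ENNReal

/-- There is a stable matching in which the numbers of students matched to their successive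
favourites are `(y i - y j) * n` up to an error of at most `a`. -/
def HasStableMatchingNear {n m K : ℕ} (L : ℕ) (y : Fin K → ℝ) (a : ℝ) (P : Market n m) : Prop :=
  ∃ μ : Fin n → Option (Fin m), P.IsStable K L μ ∧
    ∀ i j : Fin K, (j : ℕ) = i + 1 → |(P.numMatched μ i : ℝ) - (y i - y j) * n| ≤ a

section Market

variable {m n K L : ℕ} {D D' : Measure ℝ} [IsProbabilityMeasure D] [IsProbabilityMeasure D']

instance instIsProbabilityMeasureSampleLaw : IsProbabilityMeasure (sampleLaw n m D D') := by
  unfold sampleLaw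
  infer_instance

theorem hasStableMatchingNear_of_approx [NeZero m] (hL : 1 ≤ L) (hK : K ≤ m)
    {y : Fin K → ℝ} {δ c : ℝ} (hc : 0 < c)
    (hcm : c ≤ (1 - 1 / (m : ℝ)) ^ (2 * n * K))
    (hy : ∀ i, |((⌊y i * n⌋₊ : ℕ) : ℝ) - y i * n| ≤ δ)
    (hyn : ∀ i, ⌊y i * n⌋₊ ≤ 2 * n)
    (hy0 : ∀ i : Fin K, (i : ℕ) = 0 → |(n : ℝ) - (⌊y i * n⌋₊ : ℕ)| ≤ 2 * δ)
    (hys : ∀ i j : Fin K, (j : ℕ) = i + 1 → |((⌊y j * n⌋₊ : ℕ) : ℝ)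
        - meanRejected m D D' L (fun i => ⌊y i * n⌋₊) i| ≤ δ)
    {P : Market n m} (hT : TieFree (P.proposals hK))
    (hP : ∀ S, IsFinalState L (Beats (P.proposals hK)) S → ∀ i j : Fin K, (j : ℕ) = i + 1 →
      |(typeCount Prod.snd S j : ℝ) - meanRejected m D D' L (typeCount Prod.snd S) i| ≤ δ) :
    HasStableMatchingNear L y ((4 * K / c + 2) * δ) P := by
  obtain ⟨S, hS⟩ := exists_isFinalState L (Beats (P.proposals hK))
  refine ⟨P.matchingOf hK L S, P.isStable_matchingOf hK hT hS, fun i j hij => ?_⟩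
  have hle : ∀ k, typeCount Prod.snd S k ≤ 2 * n := by
    intro k
    rw [typeCount_snd]
    have := (Finset.card_le_univ ({s | (s, k) ∈ S} : Finset (Fin n))).trans (Fintype.card_fin n).le
    omega
  have hsum := sum_abs_sub_le_of_approx (m := m) (D := D) (D' := D') hL hle hyn hc hcm
    (fun i hi => by rw [hS.typeCount_zero hi]; exact hy0 i hi) (hP S hS) hys
  have hk : ∀ k, |(typeCount Prod.snd S k : ℝ) - (⌊y k * n⌋₊ : ℕ)| ≤ 2 * K * δ / c := fun k =>
    (Finset.single_le_sum (f := fun k => |(typeCount Prod.snd S k : ℝ) - (⌊y k * n⌋₊ : ℕ)|)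
      (fun _ _ => abs_nonneg _) (Finset.mem_univ k)).trans hsum
  have hnum : (P.numMatched (P.matchingOf hK L S) i : ℝ) + typeCount Prod.snd S j
      = typeCount Prod.snd S i := by exact_mod_cast P.numMatched_matchingOf hK hS hij
  have h1 := abs_le.1 (hk i)
  have h2 := abs_le.1 (hk j)
  have h3 := abs_le.1 (hy i)
  have h4 := abs_le.1 (hy j)
  -- A number of matched students is a difference of two counts, each within `2 * K * δ / c` of the
  -- rounded count of `y`, which costs another `δ` for rounding.
  have h5 : (4 * K / c + 2) * δ = 2 * (2 * K * δ / c) + 2 * δ := by ring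
  rw [h5, abs_le, sub_mul]
  constructor <;> linarith

/-- The arrays that have ties or a final state with the wrong number of rejections. -/
def exceptionalArrays (n m K L : ℕ) (D D' : Measure ℝ) (δ : ℝ) :
    Set (Fin n × Fin K → Fin m × (ℝ × ℝ)) :=
  {d | TieFree d}ᶜ ∪ {d | ∃ S, IsFinalState L (Beats d) S ∧ ∃ i j : Fin K, (j : ℕ) = i + 1 ∧
    δ ≤ |(typeCount Prod.snd S j : ℝ) - meanRejected m D D' L (typeCount Prod.snd S) i|}

omit [IsProbabilityMeasure D] [IsProbabilityMeasure D'] in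
theorem measurableSet_exceptionalArrays (δ : ℝ) :
    MeasurableSet (exceptionalArrays n m K L D D' δ) :=
  measurableSet_tieFree.compl.union (measurableSet_setOfPred.2 (measurable_of_beats fun B =>
    ∃ S, IsFinalState L B S ∧ ∃ i j : Fin K, (j : ℕ) = i + 1 ∧
      δ ≤ |(typeCount Prod.snd S j : ℝ) - meanRejected m D D' L (typeCount Prod.snd S) i|))

theorem arrayLaw_exceptionalArrays_le [NeZero m] {δ : ℝ} (hδ : 0 ≤ δ) :
    arrayLaw m D D' (Prod.snd : Fin n × Fin K → Fin K) (exceptionalArrays n m K L D D' δ)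
      ≤ ENNReal.ofReal ((n + 1) ^ K * (2 * Real.exp (-δ ^ 2 / (2 * (n * K))))) := by
  have h0 : arrayLaw m D D' (Prod.snd : Fin n × Fin K → Fin K) {d | TieFree d}ᶜ = 0 :=
    ae_tieFree (D := D) (D' := D') _
  refine (measure_union_le _ _).trans ?_
  rw [h0, zero_add, ENNReal.le_ofReal_iff_toReal_le (measure_ne_top _ _) (by positivity)]
  exact measureReal_exists_isFinalState_abs_sub_le hδ

theorem sampleLaw_exceptionalArrays_le [NeZero m] {M : ℝ} (hM : 0 < M) (hmn : (m : ℝ) = M * n)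
    (hK : K ≤ m) (hK2 : 2 * K ≤ m) {δ : ℝ} (hδ : 0 ≤ δ) :
    sampleLaw n m D D' {ω | (market ω).proposals hK ∈ exceptionalArrays n m K L D D' δ}
      ≤ ENNReal.ofReal (Real.exp (2 * K ^ 2 / M) *
        ((n + 1) ^ K * (2 * Real.exp (-δ ^ 2 / (2 * (n * K)))))) := by
  refine (sampleLaw_proposals_le hK (measurableSet_exceptionalArrays δ)).trans ?_
  rw [ENNReal.ofReal_mul (Real.exp_pos _).le]
  refine mul_le_mul' ?_ (arrayLaw_exceptionalArrays_le hδ)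
  have h := pow_div_descFactorial_pow_le hM hmn NeZero.one_le hK2
  refine le_trans (le_of_eq ?_) (ENNReal.ofReal_le_ofReal h)
  have hd : (0 : ℝ) < m.descFactorial K := by exact_mod_cast Nat.descFactorial_pos.2 hK
  rw [ENNReal.ofReal_pow (by positivity), ENNReal.ofReal_div_of_pos hd,
    ENNReal.ofReal_pow (by positivity), ENNReal.ofReal_natCast, ENNReal.ofReal_natCast]

end Market

/-! ### Passage to the limit and choice of the error -/

theorem tendsto_pow_mul_exp_neg_mul (K : ℕ) {b : ℝ} (hb : 0 < b) (C : ℝ) :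
    Tendsto (fun n : ℕ => C * (((n : ℝ) + 1) ^ K * (2 * Real.exp (-(b * n))))) atTop (𝓝 0) := by
  have hr : |Real.exp (-b)| < 1 := by
    rw [abs_of_pos (Real.exp_pos _), Real.exp_lt_one_iff]
    linarith
  have h := ((tendsto_pow_const_mul_const_pow_of_abs_lt_one K hr).comp
    (tendsto_add_atTop_nat 1)).const_mul (2 * C * Real.exp b)
  rw [mul_zero] at h
  refine h.congr fun n => ?_
  simp only [Function.comp_apply]
  have hx : Real.exp (-(b * n)) = Real.exp b * Real.exp (-b) ^ (n + 1) := by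
    rw [← Real.exp_nat_mul, ← Real.exp_add]
    congr 1
    push_cast
    ring
  rw [hx]
  push_cast
  ring

section Limit

variable {K L : ℕ} {M : ℝ} {D D' : Measure ℝ} [IsProbabilityMeasure D] [IsProbabilityMeasure D']
  {n m : ℕ → ℕ} {y : ℕ → Fin K → ℝ}

theorem tendsto_sampleLaw_hasStableMatchingNear (hK : 1 ≤ K) (hL : 1 ≤ L) (hM : 0 < M)
    (hn : Tendsto n atTop atTop) (hm : ∀ t, (m t : ℝ) = M * n t)
    (hy : IsSolution n m D D' L y) {η : ℝ} (hη : 0 < η) :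
    Tendsto (fun t => sampleLaw (n t) (m t) D D'
      {ω | HasStableMatchingNear L (y t) (η * n t) (market ω)}) atTop (𝓝 1) := by
  have hKpos : (0 : ℝ) < K := by exact_mod_cast hK
  -- All counts are at most `2 * n`, so the contraction has exponent `2 * n * K`; `c` is the lower
  -- bound of `exp_le_one_sub_inv_pow` with `a = 2 * K`.
  set c := Real.exp (-(2 * (2 * K : ℕ) / M)) with hc
  have hc0 : 0 < c := Real.exp_pos _
  set δ := η / (4 * K / c + 2) with hδ
  have hden : 0 < 4 * K / c + 2 := by positivity
  have hδ0 : 0 < δ := div_pos hη hden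
  have hδη : (4 * K / c + 2) * δ = η := mul_div_cancel₀ _ hden.ne'
  have hmlim : Tendsto m atTop atTop := by
    rw [← tendsto_natCast_atTop_iff (R := ℝ)]
    simp only [hm]
    exact (tendsto_natCast_atTop_atTop.comp hn).const_mul_atTop hM
  set e : ℕ → ℝ≥0∞ := fun t => ENNReal.ofReal (Real.exp (2 * K ^ 2 / M) *
    (((n t : ℝ) + 1) ^ K * (2 * Real.exp (-(δ ^ 2 / (2 * K) * n t))))) with he
  have helim : Tendsto (fun t => 1 - e t) atTop (𝓝 1) := by
    have h1 := (tendsto_pow_mul_exp_neg_mul K (b := δ ^ 2 / (2 * K)) (by positivity)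
      (Real.exp (2 * K ^ 2 / M))).comp hn
    have h2 := ENNReal.tendsto_ofReal h1
    rw [ENNReal.ofReal_zero] at h2
    have h3 := ENNReal.Tendsto.sub (tendsto_const_nhds (x := (1 : ℝ≥0∞)) (f := atTop)) h2
      (Or.inl ENNReal.one_ne_top)
    simpa using h3
  refine tendsto_of_tendsto_of_tendsto_of_le_of_le' helim tendsto_const_nhds ?_
    (Eventually.of_forall fun t => prob_le_one)
  filter_upwards [hy.eventually_approx hn (hmlim.eventually_gt_atTop 0) hδ0,
    hmlim.eventually_ge_atTop (2 * K), hn.eventually_gt_atTop 0] with t ht hmt hnt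
  obtain ⟨h1, h2, h3, h4⟩ := ht
  have hn0 : (0 : ℝ) < n t := by exact_mod_cast hnt
  have : NeZero (m t) := ⟨by omega⟩
  have hKm : K ≤ m t := by omega
  have hbad := sampleLaw_exceptionalArrays_le (n := n t) (m := m t) (L := L) (D := D) (D' := D')
    hM (hm t) hKm hmt (mul_nonneg hδ0.le hn0.le)
  have hexp : -(δ * n t) ^ 2 / (2 * (n t * K)) = -(δ ^ 2 / (2 * K) * n t) := by
    field_simp
  rw [hexp] at hbad
  have hcm : c ≤ (1 - 1 / (m t : ℝ)) ^ (2 * n t * K) := by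
    have := exp_le_one_sub_inv_pow hM (hm t) (by omega) (2 * K)
    rwa [mul_left_comm, ← mul_assoc] at this
  -- Measurability is needed only for the exceptional event; the event of the conclusion contains
  -- its complement, and monotonicity suffices.
  have hmeas : MeasurableSet {ω : Sample (n t) (m t) | (market ω).proposals hKm ∈
      exceptionalArrays (n t) (m t) K L D D' (δ * n t)} :=
    measurable_market_proposals hKm (measurableSet_exceptionalArrays _)
  calc 1 - e t ≤ 1 - sampleLaw (n t) (m t) D D' {ω | (market ω).proposals hKm ∈
        exceptionalArrays (n t) (m t) K L D D' (δ * n t)} := tsub_le_tsub_left hbad 1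
    _ = sampleLaw (n t) (m t) D D' {ω | (market ω).proposals hKm ∈
        exceptionalArrays (n t) (m t) K L D D' (δ * n t)}ᶜ := (prob_compl_eq_one_sub hmeas).symm
    _ ≤ _ := by
      refine measure_mono fun ω hω => ?_
      have hω' : (market ω).proposals hKm ∉ exceptionalArrays (n t) (m t) K L D D' (δ * n t) := hω
      rw [exceptionalArrays, Set.mem_union, not_or] at hω'
      have := hasStableMatchingNear_of_approx (D := D) (D' := D') hL hKm hc0 hcm h1 h2 h3 h4
        (not_not.1 hω'.1) fun S hS i j hij => by
          by_contra hlt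
          exact hω'.2 ⟨S, hS, i, j, hij, (not_le.1 hlt).le⟩
      rw [← mul_assoc, hδη] at this
      exact this

end Limit

/-- Take for `κ t` the largest `k ≤ t` with `p k t ≥ 1 - 1 / (k + 1)`. The value `k = 0` always
qualifies, its bound being 0, and every fixed `k` qualifies eventually, so `κ` tends to infinity. -/
theorem exists_tendsto_diagonal {p : ℕ → ℕ → ℝ≥0∞} (hp : ∀ k t, p k t ≤ 1)
    (h : ∀ k, Tendsto (p k) atTop (𝓝 1)) :
    ∃ κ : ℕ → ℕ, Tendsto κ atTop atTop ∧ Tendsto (fun t => p (κ t) t) atTop (𝓝 1) := by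
  classical
  let good : ℕ → ℕ → Prop := fun t k => 1 - ((k + 1 : ℕ) : ℝ≥0∞)⁻¹ ≤ p k t
  let κ : ℕ → ℕ := fun t => Nat.findGreatest (good t) t
  have hgood : ∀ t, good t (κ t) := fun t =>
    Nat.findGreatest_spec (Nat.zero_le t) (by simp [good])
  have hκ : Tendsto κ atTop atTop := by
    refine tendsto_atTop.2 fun k => ?_
    have hlt : 1 - ((k + 1 : ℕ) : ℝ≥0∞)⁻¹ < 1 :=
      ENNReal.sub_lt_self ENNReal.one_ne_top one_ne_zero
        (ENNReal.inv_ne_zero.2 (ENNReal.natCast_ne_top _))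
    filter_upwards [(h k).eventually (lt_mem_nhds hlt), eventually_ge_atTop k] with t ht hkt
    exact Nat.le_findGreatest hkt ht.le
  refine ⟨κ, hκ, ?_⟩
  have hlim : Tendsto (fun t => 1 - ((κ t + 1 : ℕ) : ℝ≥0∞)⁻¹) atTop (𝓝 1) := by
    have := ENNReal.Tendsto.sub (tendsto_const_nhds (x := (1 : ℝ≥0∞)) (f := atTop))
      (ENNReal.tendsto_inv_nat_nhds_zero.comp ((tendsto_add_atTop_nat 1).comp hκ))
      (Or.inl ENNReal.one_ne_top)
    simpa using this
  exact tendsto_of_tendsto_of_tendsto_of_le_of_le hlim tendsto_const_nhds hgood fun t => hp _ _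

end MatchingMarket

theorem theorem4 (K L : ℕ) (hK : 1 ≤ K) (hL : 1 ≤ L) (M : ℝ) (hM : 0 < M)
    (D D' : Measure ℝ) [IsProbabilityMeasure D] [IsProbabilityMeasure D']
    (n m : ℕ → ℕ) (hn : Tendsto n atTop atTop) (hm : ∀ t, (m t : ℝ) = M * n t)
    (y : ℕ → Fin K → ℝ) (hy : MatchingMarket.IsSolution n m D D' L y) :
    ∃ g : ℕ → ℝ, g =o[atTop] (fun t => (n t : ℝ)) ∧
      Tendsto (fun t => MatchingMarket.sampleLaw (n t) (m t) D D'
        {ω | ∃ μ : Fin (n t) → Option (Fin (m t)),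
          (MatchingMarket.market ω).IsStable K L μ ∧
          ∀ i j : Fin K, (j : ℕ) = i + 1 →
            |((MatchingMarket.market ω).numMatched μ i : ℝ) - (y t i - y t j) * n t| ≤ g t})
        atTop (𝓝 1) := by
  -- The error `n / (k + 1)` is admissible for every fixed `k`; along `κ t → ∞` it becomes `o(n)`.
  obtain ⟨κ, hκ, h⟩ := MatchingMarket.exists_tendsto_diagonal
    (p := fun k t => MatchingMarket.sampleLaw (n t) (m t) D D' {ω |
      MatchingMarket.HasStableMatchingNear L (y t) (1 / ((k : ℝ) + 1) * n t)
        (MatchingMarket.market ω)})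
    (fun _ _ => prob_le_one)
    (fun k => MatchingMarket.tendsto_sampleLaw_hasStableMatchingNear hK hL hM hn hm hy
      (by positivity))
  refine ⟨fun t => 1 / ((κ t : ℝ) + 1) * n t, ?_, h⟩
  have h0 : Tendsto (fun t => 1 / ((κ t : ℝ) + 1)) atTop (𝓝 0) :=
    tendsto_one_div_add_atTop_nhds_zero_nat.comp hκ
  simpa using ((Asymptotics.isLittleO_one_iff ℝ).2 h0).mul_isBigO
    (Asymptotics.isBigO_refl (fun t => (n t : ℝ)) atTop)
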